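/- Let $r,s\in\mathbb{Z}_{\ge 0}$ with $r\ge s$. *Volume functions.* For $j=1,\dots,s$ let $a_j>0$ be real, and for $1\le i\le r+s$, $1\le j\le s$ let $k_{i,j}\in\mathbb{R}$ be such that $k_{r-s+j,j}\neq 0$, $k_{i,j}=0$ for $r-s+j<i\le r$, $k_{r+j,j}\ne 0$, and $k_{i,j}=0$ for $r+j<i\le r+s$. Put $A=\sum_{j=1}^s a_j$ and $A_i=\sum_{j=1}^s a_jk_{i,j}$. Let $V_{r+s}:\mathbb{R}_{\ge 0}^{r+s}\times\mathbb{R}_{\ge 3}\to\mathbb{R}$ be a non-negative function such that $$V_{r+s}(\eta_1,\dots,\eta_{r+s};B)\ll \frac{B^{1-A}}{\eta_1^{1-A_1}\cdots\eta_{r+s}^{1-A_{r+s}}}$$ with an implied constant independent of $\eta_1,\dots,\eta_{r+s}>0$ and $B$, and such that $V_{r+s}(\eta_1,\dots,\eta_{r+s};B)=0$ unless both $\eta_1^{k_{1,j}}\cdots\eta_{r+s}^{k_{r+s,j}}\le B$ for $j=1,\dots,s$ and $1\le\eta_i\le B$ for $i=1,\dots,r+s$. For $\ell=r+s-1,\dots,0$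 define recursively $$V_\ell(\eta_1,\dots,\eta_\ell;B)=\int_{0}^\infty V_{\ell+1}(\eta_1,\dots,\eta_{\ell+1};B)\,d\eta_{\ell+1}.$$ Assume that there is an $N\in\mathbb{Z}_{\ge 0}$ such that, for all $\ell\in\{1,\dots,r+s\}$, all $B\ge 3$ and all $\eta_1,\dots,\eta_{\ell-1}\ge 0$, the function $V_\ell$ as a function of $\eta_\ell\in[1,B]$ has a continuous derivative whose sign changes at most $N$ times. *Arithmetic functions.* Let $C\in\mathbb{R}_{\ge 0}$. - $\Theta_{0,0}(C)=\mathbb{R}$. For $n\ge 1$, $\Theta_{0,n}(C)$ is the set of non-negative functions $\theta:\mathbb{Z}_{>0}^n\to\mathbb{R}$ such that for every $i\in\{1,\dots,n\}$ there is $\theta_i\in\Theta_{0,n-1}(C)$ with $\sum_{0<\eta_i\le t}\theta(\eta_1,\dots,\eta_n)\le\theta_i(\eta_1,\dots,\eta_{i-1},\eta_{i+1},\dots,\eta_n)\,t(\log(t+2))^C$ for all $t\ge 0$ and all values of the remaining variables. - $\Theta_0(C)$ is the set of non-negative functions $\theta:\mathbb{Z}_{>0}\to\mathbb{R}$ for which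 there are $c\ge 0$ and a bounded function $E:\mathbb{R}_{\ge 0}\to\mathbb{R}$ with $\sum_{0<n\le t}\theta(n)=ct+E(t)(\log(t+2))^C$ for all $t\ge 0$. These are unique, and we write $\mathcal{A}(\theta(n),n)=c$ and $\mathcal{E}(\theta(n),n)=\sup_{t\ge 0}|E(t)|$. - For $n\ge 1$, $\Theta_{1,n}(C,\eta_n)$ is the set of $\theta\in\Theta_{0,n}(0)$ that lie in $\Theta_0(C)$ as a function of $\eta_n$ for all $\eta_1,\dots,\eta_{n-1}\in\mathbb{Z}_{>0}$ and for which, as functions of $\eta_1,\dots,\eta_{n-1}$, $\mathcal{A}(\theta(\eta_1,\dots,\eta_n),\eta_n)\in\Theta_{0,n-1}(0)$ and $\mathcal{E}(\theta(\eta_1,\dots,\eta_n),\eta_n)\in\Theta_{0,n-1}(C)$. - $\Theta_{2,0}(C)=\mathbb{R}$. For $n\ge 1$, $\Theta_{2,n}(C)$ is the set of $\theta\in\Theta_{1,n}(C,\eta_n)$ with $\mathcal{A}(\theta(\eta_1,\dots,\eta_n),\eta_n)\in\Theta_{2,n-1}(C)$. *Proposition.* Let $V_{r+s}$ be as above and let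 $\theta_{r+s}\in\Theta_{2,r+s}(C)$ for some $C\in\mathbb{R}_{\ge 0}$. Then, for all $B\ge 3$, $$\sum_{\eta_1,\dots,\eta_{r+s}\in\mathbb{Z}_{>0}}\theta_{r+s}(\eta_1,\dots,\eta_{r+s})V_{r+s}(\eta_1,\dots,\eta_{r+s};B)=c_0\int V_{r+s}(\eta_1,\dots,\eta_{r+s};B)\,d\eta_{r+s}\cdots d\eta_1+O\left(B(\log B)^{r-1}(\log\log B)^{\max\{1,s\}}\right),$$ where the integral is the iterated integral $V_0(B)$ over $\mathbb{R}_{\ge 0}^{r+s}$, $c_0$ is the iterated average obtained from $\theta_{r+s}$ by successively applying $\mathcal{A}(\cdot,\eta_{r+s}),\dots,\mathcal{A}(\cdot,\eta_1)$, and the implied constant is independent of $B$ (it may depend on everything else, in particular on $V_{r+s}$ and $\theta_{r+s}$). -/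

import Mathlib

open MeasureTheory

noncomputable section

namespace SeveralSummations

/-- The partial sum of `θ(n)` over all integers `0 < n ≤ t`. -/
def partialSum (θ : ℕ+ → ℝ) (t : ℝ) : ℝ :=
  ∑ m ∈ Finset.range ⌊t⌋₊, θ m.succPNat

/-- `θ(η₁, …, ηₙ, m)` as a function of its last variable `m`. -/
def lastSlice {n : ℕ} (θ : (Fin (n + 1) → ℕ+) → ℝ) (η : Fin n → ℕ+) : ℕ+ → ℝ :=
  fun m => θ (Fin.snoc (α := fun _ => ℕ+) η m)

/-- The set `Θ_{0,n}(C)`: all of `ℝ` for `n = 0`; for `n > 0`, the non-negative functions on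
`ℤ_{>0}^n` such that summing over any one variable `0 < η_i ≤ t` gives at most
`t (log (t + 2))^C` times a function in `Θ_{0,n-1}(C)` of the remaining variables. -/
def ThetaBound (C : ℝ) : (n : ℕ) → Set ((Fin n → ℕ+) → ℝ)
  | 0 => Set.univ
  | n + 1 => {θ | (∀ η, 0 ≤ θ η) ∧
      ∀ i : Fin (n + 1), ∃ θi ∈ ThetaBound C n, ∀ (η : Fin n → ℕ+) (t : ℝ), 0 ≤ t →
        partialSum (fun m => θ (Fin.insertNth (α := fun _ => ℕ+) i m η)) t
          ≤ θi η * (t * Real.log (t + 2) ^ C)}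

/-- `c ≥ 0` is the average of `θ`: `∑_{0 < n ≤ t} θ(n) = c t + E(t) (log (t + 2))^C` for all
`t ≥ 0`, with `E` bounded. -/
def IsAverage (C : ℝ) (θ : ℕ+ → ℝ) (c : ℝ) : Prop :=
  0 ≤ c ∧ ∃ E : ℝ → ℝ, (∃ M : ℝ, ∀ t, 0 ≤ t → |E t| ≤ M) ∧
    ∀ t, 0 ≤ t → partialSum θ t = c * t + E t * Real.log (t + 2) ^ C

/-- The set `Θ_0(C)` of non-negative functions of one variable having an average. -/
def ThetaAvg (C : ℝ) : Set (ℕ+ → ℝ) :=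
  {θ | (∀ n, 0 ≤ θ n) ∧ ∃ c, IsAverage C θ c}

/-- The average is uniquely determined. -/
theorem IsAverage.unique {C : ℝ} {θ : ℕ+ → ℝ} {c d : ℝ}
    (hc : IsAverage C θ c) (hd : IsAverage C θ d) : c = d := by
  obtain ⟨-, E, ⟨M, hM⟩, hE⟩ := hc
  obtain ⟨-, F, ⟨N, hN⟩, hF⟩ := hd
  by_contra hne
  have hpos : 0 < |c - d| := abs_pos.mpr (sub_ne_zero.mpr hne)
  have key : ∀ t : ℝ, 0 ≤ t → |c - d| * t ≤ (M + N) * Real.log (t + 2) ^ C := by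
    intro t ht
    have hlog : 0 ≤ Real.log (t + 2) ^ C :=
      Real.rpow_nonneg (Real.log_nonneg (by linarith)) C
    have h1 : (c - d) * t = (F t - E t) * Real.log (t + 2) ^ C := by
      have h2 := hE t ht
      have h3 := hF t ht
      linarith
    calc |c - d| * t = |(c - d) * t| := by rw [abs_mul, abs_of_nonneg ht]
      _ = |F t - E t| * Real.log (t + 2) ^ C := by rw [h1, abs_mul, abs_of_nonneg hlog]
      _ ≤ (M + N) * Real.log (t + 2) ^ C := by
        refine mul_le_mul_of_nonneg_right ?_ hlog
        have h4 := abs_sub (F t) (E t)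
        have h5 := hM t ht
        have h6 := hN t ht
        linarith
  have ho := (isLittleO_log_rpow_rpow_atTop C (one_pos : (0 : ℝ) < 1))
  have hlim : Filter.Tendsto (fun t : ℝ => t + 2) Filter.atTop Filter.atTop :=
    Filter.tendsto_atTop_add_const_right _ _ Filter.tendsto_id
  have ho2 := ho.comp_tendsto hlim
  have hMN : 0 < |M + N| + 1 := by positivity
  have hb := ho2.bound (show 0 < |c - d| / (4 * (|M + N| + 1)) by positivity)
  obtain ⟨t, ht, ht2⟩ := (hb.and (Filter.eventually_ge_atTop (3 : ℝ))).exists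
  have hk := key t (by linarith)
  have hlog : 0 ≤ Real.log (t + 2) ^ C :=
    Real.rpow_nonneg (Real.log_nonneg (by linarith)) C
  simp only [Function.comp_apply, Real.rpow_one, Real.norm_eq_abs, abs_of_nonneg hlog] at ht
  rw [abs_of_nonneg (by linarith : (0 : ℝ) ≤ t + 2)] at ht
  have h7 : (M + N) * Real.log (t + 2) ^ C ≤ (|M + N| + 1) * Real.log (t + 2) ^ C :=
    mul_le_mul_of_nonneg_right (by linarith [le_abs_self (M + N)]) hlog
  have h8 : (|M + N| + 1) * Real.log (t + 2) ^ C ≤ |c - d| / 4 * (t + 2) := by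
    calc (|M + N| + 1) * Real.log (t + 2) ^ C
        ≤ (|M + N| + 1) * (|c - d| / (4 * (|M + N| + 1)) * (t + 2)) :=
          mul_le_mul_of_nonneg_left ht hMN.le
      _ = |c - d| / 4 * (t + 2) := by field_simp
  nlinarith

open Classical in
/-- The average `A(θ(n), n)` of `θ ∈ Θ_0(C)` (and `0` for other functions). -/
def average (C : ℝ) (θ : ℕ+ → ℝ) : ℝ :=
  if h : ∃ c, IsAverage C θ c then h.choose else 0

/-- For `θ ∈ Θ_0(C)`, the number `E(θ(n), n) = sup_{t ≥ 0} |E(t)|`, where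
`E(t) = (∑_{0 < n ≤ t} θ(n) - A(θ(n), n) t) / (log (t + 2))^C`. -/
def errorSup (C : ℝ) (θ : ℕ+ → ℝ) : ℝ :=
  sSup ((fun t : ℝ => |(partialSum θ t - average C θ * t) / Real.log (t + 2) ^ C|) '' Set.Ici 0)

/-- `A(θ(η₁, …, ηₙ₊₁), ηₙ₊₁)`, a function of `η₁, …, ηₙ`. -/
def averageLast (C : ℝ) {n : ℕ} (θ : (Fin (n + 1) → ℕ+) → ℝ) : (Fin n → ℕ+) → ℝ :=
  fun η => average C (lastSlice θ η)

/-- `E(θ(η₁, …, ηₙ₊₁), ηₙ₊₁)`, a function of `η₁, …, ηₙ`. -/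
def errorSupLast (C : ℝ) {n : ℕ} (θ : (Fin (n + 1) → ℕ+) → ℝ) : (Fin n → ℕ+) → ℝ :=
  fun η => errorSup C (lastSlice θ η)

/-- The set `Θ_{1,n+1}(C, ηₙ₊₁)` of functions in `n + 1` variables. -/
def ThetaAvgLast (C : ℝ) (n : ℕ) : Set ((Fin (n + 1) → ℕ+) → ℝ) :=
  {θ | θ ∈ ThetaBound 0 (n + 1) ∧
    (∀ η, lastSlice θ η ∈ ThetaAvg C) ∧
    averageLast C θ ∈ ThetaBound 0 n ∧
    errorSupLast C θ ∈ ThetaBound C n}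

/-- The set `Θ_{2,n}(C)`: all of `ℝ` for `n = 0`; for `n > 0`, the functions in
`Θ_{1,n}(C, ηₙ)` whose average over `ηₙ` lies in `Θ_{2,n-1}(C)`. -/
def ThetaIter (C : ℝ) : (n : ℕ) → Set ((Fin n → ℕ+) → ℝ)
  | 0 => Set.univ
  | n + 1 => {θ | θ ∈ ThetaAvgLast C n ∧ averageLast C θ ∈ ThetaIter C n}

/-- The iterated average `A(θ(η₁, …, ηₙ), ηₙ, …, η₁)`. -/
def iteratedAverage (C : ℝ) : (n : ℕ) → ((Fin n → ℕ+) → ℝ) → ℝ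
  | 0, θ => θ Fin.elim0
  | n + 1, θ => iteratedAverage C n (averageLast C θ)

/-- `V_n(η₁, …, ηₙ; B) = ∫ V_{n+1}(η₁, …, ηₙ₊₁; B) dηₙ₊₁`. -/
def lastIntegral {n : ℕ} (V : (Fin (n + 1) → ℝ) → ℝ → ℝ) : (Fin n → ℝ) → ℝ → ℝ :=
  fun η B => ∫ t in Set.Ici (0 : ℝ), V (Fin.snoc (α := fun _ => ℝ) η t) B

/-- The iterated integral of `V(η₁, …, ηₙ; B)` over `ηₙ, …, η₁` (in this order). -/
def iteratedIntegral : (n : ℕ) → ((Fin n → ℝ) → ℝ → ℝ) → ℝ → ℝ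
  | 0, V, B => V Fin.elim0 B
  | n + 1, V, B => iteratedIntegral n (lastIntegral V) B

/-- On `[a, b]`, `f` has a continuous derivative whose sign changes at most `N` times, i.e.
`[a, b]` splits into `N + 1` (possibly degenerate) intervals on each of which the derivative
is everywhere `≥ 0` or everywhere `≤ 0`. -/
def HasFewSignChanges (N : ℕ) (a b : ℝ) (f : ℝ → ℝ) : Prop :=
  ContDiffOn ℝ 1 f (Set.Icc a b) ∧
  ∃ t : Fin (N + 2) → ℝ, Monotone t ∧ t 0 = a ∧ t (Fin.last (N + 1)) = b ∧
    ∀ i : Fin (N + 1),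
      (∀ x ∈ Set.Icc (t i.castSucc) (t i.succ), 0 ≤ derivWithin f (Set.Icc a b) x) ∨
      (∀ x ∈ Set.Icc (t i.castSucc) (t i.succ), derivWithin f (Set.Icc a b) x ≤ 0)

/-- With `V_n = V` and `V_{ℓ-1} = ∫ V_ℓ dη_ℓ`, each of `V_n, …, V_1` has, as a function of its
last variable on `[1, B]`, a continuous derivative whose sign changes at most `N` times, for all
values of the other variables and of `B`. -/
def IteratedFewSignChanges (N : ℕ) : (n : ℕ) → ((Fin n → ℝ) → ℝ → ℝ) → Prop
  | 0, _ => True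
  | n + 1, V =>
      (∀ B : ℝ, 3 ≤ B → ∀ η : Fin n → ℝ, (∀ i, 0 ≤ η i) →
        HasFewSignChanges N 1 B (fun t => V (Fin.snoc (α := fun _ => ℝ) η t) B)) ∧
      IteratedFewSignChanges N n (lastIntegral V)

/-- The conditions on the exponents `k_{i,j}`, `1 ≤ i ≤ r + s`, `1 ≤ j ≤ s` (for `s ≤ r`):
`k_{r-s+j,j} ≠ 0`, `k_{i,j} = 0` for `r-s+j < i ≤ r`, `k_{r+j,j} ≠ 0`, and `k_{i,j} = 0` for
`r+j < i ≤ r+s`. Both indices are counted from `0` in the code. -/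
structure AdmissibleExponents (r s : ℕ) (k : Fin (r + s) → Fin s → ℝ) : Prop where
  ne_zero_left : ∀ (i : Fin (r + s)) (j : Fin s), (i : ℕ) + s = r + j → k i j ≠ 0
  eq_zero_left : ∀ (i : Fin (r + s)) (j : Fin s),
    r + (j : ℕ) < (i : ℕ) + s → (i : ℕ) < r → k i j = 0
  ne_zero_right : ∀ (i : Fin (r + s)) (j : Fin s), (i : ℕ) = r + j → k i j ≠ 0
  eq_zero_right : ∀ (i : Fin (r + s)) (j : Fin s), r + (j : ℕ) < (i : ℕ) → k i j = 0

/-- The conditions on the function `V(η₁, …, η_{r+s}; B)`, `η_i ≥ 0`, `B ≥ 3`. Values of `V`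
outside this domain are irrelevant. -/
structure IsVolumeFunction (r s : ℕ) (a : Fin s → ℝ) (k : Fin (r + s) → Fin s → ℝ)
    (V : (Fin (r + s) → ℝ) → ℝ → ℝ) : Prop where
  nonneg : ∀ B : ℝ, 3 ≤ B → ∀ η : Fin (r + s) → ℝ, (∀ i, 0 ≤ η i) → 0 ≤ V η B
  bound : ∃ K : ℝ, ∀ B : ℝ, 3 ≤ B → ∀ η : Fin (r + s) → ℝ, (∀ i, 0 < η i) →
    V η B ≤ K * (B ^ (1 - ∑ j, a j) / ∏ i, η i ^ (1 - ∑ j, a j * k i j))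
  height : ∀ B : ℝ, 3 ≤ B → ∀ η : Fin (r + s) → ℝ, (∀ i, 0 ≤ η i) → V η B ≠ 0 →
    ∀ j, ∏ i, η i ^ k i j ≤ B
  range : ∀ B : ℝ, 3 ≤ B → ∀ η : Fin (r + s) → ℝ, (∀ i, 0 ≤ η i) → V η B ≠ 0 →
    ∀ i, 1 ≤ η i ∧ η i ≤ B
  regular : ∃ N : ℕ, IteratedFewSignChanges N (r + s) V

end SeveralSummations

end

/-!
The sums over `η_{r+s}, …, η₁` are replaced by integrals one at a time, starting with the last
variable. At each step, `θ` is replaced by its average over the last variable, and `V` by its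
integral over that variable, and the error has to be `O(B (log B)^{r-1} log log B)`; the higher
powers of `log log B` in the statement are not needed, since `log log B` is bounded below.

*Upper bounds.* With `P_j = ∏ i, η i ^ k i j`, the bound for `V` is
`B / ∏ η i * ∏ j, (P_j / B) ^ a_j` on the set where all `P_j ≤ B`. There,
`(P_j / B) ^ a_j ≤ 2 bump ((P_j / B) ^ ε)` for small `ε > 0`, where `bump y = 1 / (y + y⁻¹)`
(`IsVolumeFunction.isControlled`). Both the support condition and the power are thus encoded in the
weight `bump`, for which `∫₁^B t⁻¹ bump (Y t ^ κ) dt` is bounded independently of `Y`; for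
`|κ| ≤ 1`, so is the corresponding sum. Hence each of the last `s` integrations uses up one height
condition at the cost of a constant (`IsControlled.lastIntegral_height`), and each of the first `r`
costs a factor `log B` (`IsControlled.lastIntegral_log`).

*One step* (`exists_sum_sub_sum_lastIntegral_le`). The range of the last variable is split at
`T = (log B)^D`. For the part above `T`, Abel summation compares the sum and the integral
(`abs_sum_sub_integral_le`); as the derivative changes sign a bounded number of times, the error is
at most a constant times `sup V` times the error of the partial sums. Since all weights `bump` are
at most `1`, `sup V` is at most `B / ∏ η i` up to powers of `log B`, with a factor `T⁻¹` from the
last variable. If `D` is large, this factor outweighs all logarithms coming from the sum over the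
other variables. Below `T`, the sum and the integral are estimated separately: the last
variable contributes `1 + log T`, which is of order `log log B`, and in the sum over the other
variables every remaining height condition saves a factor `log B`. For the latter, the `j`-th height
condition is used for the variable with number `r - s + j` (`exists_sum_heightWeight_le`), so that
the last variable, which may be among the last `s`, is free.
-/

noncomputable section

namespace SeveralSummations

/-! ### One-variable sums and integrals -/

/-- Partial summation against a non-negative antitone weight: a sequence whose partial sums are at
most those of the constant sequence `c` can be replaced by that constant. -/
lemma sum_mul_le_of_antitone {d g : ℕ → ℝ} {c : ℝ} {M : ℕ}
    (hd : ∀ m ≤ M, ∑ i ∈ Finset.range m, d i ≤ c * m) (hg : Antitone g) (h0 : ∀ m, 0 ≤ g m) :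
    ∑ i ∈ Finset.range M, d i * g i ≤ c * ∑ i ∈ Finset.range M, g i := by
  have hD : ∀ m ≤ M, 0 ≤ ∑ i ∈ Finset.range m, (c - d i) := by
    intro m hm
    have := hd m hm
    simp only [Finset.sum_sub_distrib, Finset.sum_const, Finset.card_range, nsmul_eq_mul]
    linarith [mul_comm c (m : ℝ)]
  have key : ∀ m ≤ M, g m * ∑ i ∈ Finset.range m, (c - d i)
      ≤ ∑ i ∈ Finset.range m, (c - d i) * g i := by
    intro m
    induction m with
    | zero => simp
    | succ m ih =>
      intro hm
      have h1 := ih (by omega)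
      have h2 := mul_le_mul_of_nonneg_right (hg (Nat.le_succ m)) (hD (m + 1) hm)
      refine h2.trans ?_
      rw [Finset.sum_range_succ, Finset.sum_range_succ]
      linarith [mul_add (g m) (∑ i ∈ Finset.range m, (c - d i)) (c - d m),
        mul_comm (g m) (c - d m)]
  have h := (mul_nonneg (h0 M) (hD M le_rfl)).trans (key M le_rfl)
  simp only [sub_mul, Finset.sum_sub_distrib, ← Finset.mul_sum] at h
  linarith

/-- The smooth weight `1 / (y + y⁻¹)`. For `0 < y ≤ 1` it is comparable to `y`; unlike the
indicator function of `y ≤ 1` times `y`, it is invariant under `y ↦ y⁻¹`, and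
`t⁻¹ * bump (Y * t ^ κ)` has the elementary antiderivative `κ⁻¹ * arctan (Y * t ^ κ)`. -/
def bump (y : ℝ) : ℝ := (y + y⁻¹)⁻¹

lemma bump_nonneg {y : ℝ} (hy : 0 < y) : 0 ≤ bump y := by unfold bump; positivity

lemma bump_le_one {y : ℝ} (hy : 0 < y) : bump y ≤ 1 := by
  unfold bump
  apply inv_le_one_of_one_le₀
  have h : y * y⁻¹ = 1 := mul_inv_cancel₀ hy.ne'
  have := inv_pos.mpr hy
  nlinarith [sq_nonneg (y - y⁻¹), sq_nonneg (y + y⁻¹ - 1)]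

lemma le_two_mul_bump {y : ℝ} (hy : 0 < y) (hy1 : y ≤ 1) : y ≤ 2 * bump y := by
  unfold bump
  have h : 0 < y + y⁻¹ := by positivity
  rw [← div_eq_mul_inv, le_div_iff₀ h, mul_add, mul_inv_cancel₀ hy.ne']
  nlinarith

lemma inv_mul_bump_eq {Y κ t : ℝ} (ht : 0 < t) :
    t⁻¹ * bump (Y * t ^ κ) = (Y * t ^ (1 + κ) + Y⁻¹ * t ^ (1 - κ))⁻¹ := by
  unfold bump
  rw [← mul_inv, mul_add, Real.rpow_add ht, Real.rpow_sub ht, Real.rpow_one, mul_inv]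
  congr 1
  ring

lemma antitoneOn_inv_mul_bump {Y κ : ℝ} (hY : 0 < Y) (hκ : |κ| ≤ 1) :
    AntitoneOn (fun t : ℝ => t⁻¹ * bump (Y * t ^ κ)) (Set.Ioi 0) := by
  intro x hx y hy hxy
  have hx' : 0 < x := hx
  have hy' : 0 < y := hy
  simp only
  rw [inv_mul_bump_eq hx', inv_mul_bump_eq hy']
  have := abs_le.mp hκ
  gcongr <;> linarith

lemma continuousOn_inv_mul_bump {Y κ : ℝ} (hY : 0 < Y) :
    ContinuousOn (fun t : ℝ => t⁻¹ * bump (Y * t ^ κ)) (Set.Ioi 0) := by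
  intro t ht
  have ht' : 0 < t := ht
  have h1 : ContinuousAt (fun t : ℝ => t ^ κ) t :=
    Real.continuousAt_rpow_const _ _ (Or.inl ht'.ne')
  have h2 : 0 < Y * t ^ κ := by positivity
  have h3 : Y * t ^ κ + (Y * t ^ κ)⁻¹ ≠ 0 := by positivity
  unfold bump
  exact ((continuousAt_id.inv₀ ht'.ne').mul (((continuousAt_const.mul h1).add
    ((continuousAt_const.mul h1).inv₀ h2.ne')).inv₀ h3)).continuousWithinAt

lemma intervalIntegrable_inv_mul_bump {Y κ b : ℝ} (hY : 0 < Y) (hb : 1 ≤ b) :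
    IntervalIntegrable (fun t : ℝ => t⁻¹ * bump (Y * t ^ κ)) volume 1 b := by
  apply ContinuousOn.intervalIntegrable
  refine (continuousOn_inv_mul_bump hY).mono ?_
  rw [Set.uIcc_of_le hb]
  intro x hx
  exact lt_of_lt_of_le one_pos hx.1

lemma integral_inv_mul_bump_le {Y κ b : ℝ} (hY : 0 < Y) (hκ : κ ≠ 0) (hb : 1 ≤ b) :
    ∫ t in (1 : ℝ)..b, t⁻¹ * bump (Y * t ^ κ) ≤ Real.pi / |κ| := by
  have hderiv : ∀ t ∈ Set.uIcc 1 b,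
      HasDerivAt (fun t : ℝ => κ⁻¹ * Real.arctan (Y * t ^ κ)) (t⁻¹ * bump (Y * t ^ κ)) t := by
    intro t ht
    rw [Set.uIcc_of_le hb] at ht
    have ht' : 0 < t := lt_of_lt_of_le one_pos ht.1
    have h := (((Real.hasDerivAt_rpow_const (p := κ) (Or.inl ht'.ne')).const_mul Y).arctan).const_mul
      κ⁻¹
    refine h.congr_deriv ?_
    have hp : 0 < t ^ κ := Real.rpow_pos_of_pos ht' κ
    rw [Real.rpow_sub ht', Real.rpow_one]
    unfold bump
    field_simp
    ring
  rw [intervalIntegral.integral_eq_sub_of_hasDerivAt hderiv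
    (intervalIntegrable_inv_mul_bump hY hb)]
  rw [← mul_sub]
  refine (le_abs_self _).trans ?_
  rw [abs_mul, abs_inv, div_eq_mul_inv, mul_comm]
  gcongr
  rw [abs_le]
  constructor <;> linarith [Real.arctan_lt_pi_div_two (Y * b ^ κ),
    Real.neg_pi_div_two_lt_arctan (Y * b ^ κ), Real.arctan_lt_pi_div_two (Y * 1 ^ κ),
    Real.neg_pi_div_two_lt_arctan (Y * 1 ^ κ)]

lemma antitone_nat_inv_mul_bump {Y κ : ℝ} (hY : 0 < Y) (hκ : |κ| ≤ 1) :
    Antitone (fun m : ℕ => ((m : ℝ) + 1)⁻¹ * bump (Y * ((m : ℝ) + 1) ^ κ)) := by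
  intro m n hmn
  refine antitoneOn_inv_mul_bump hY hκ (a := (m : ℝ) + 1) (b := (n : ℝ) + 1) ?_ ?_ ?_
  · simp only [Set.mem_Ioi]; positivity
  · simp only [Set.mem_Ioi]; positivity
  · have : (m : ℝ) ≤ n := by exact_mod_cast hmn
    linarith

lemma sum_inv_mul_bump_le {Y κ : ℝ} (hY : 0 < Y) (hκ : κ ≠ 0) (hκ1 : |κ| ≤ 1) (M : ℕ) :
    ∑ m ∈ Finset.range M, ((m : ℝ) + 1)⁻¹ * bump (Y * ((m : ℝ) + 1) ^ κ)
      ≤ 1 + Real.pi / |κ| := by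
  cases M with
  | zero => simp only [Finset.range_zero, Finset.sum_empty]; positivity
  | succ M =>
    rw [Finset.sum_range_succ']
    have h1 : (((0 : ℕ) : ℝ) + 1)⁻¹ * bump (Y * (((0 : ℕ) : ℝ) + 1) ^ κ) ≤ 1 := by
      simpa using bump_le_one hY
    have h2 := AntitoneOn.sum_le_integral (x₀ := 1) (a := M)
      (f := fun t : ℝ => t⁻¹ * bump (Y * t ^ κ))
      ((antitoneOn_inv_mul_bump hY hκ1).mono fun x hx => lt_of_lt_of_le one_pos hx.1)
    have h3 := integral_inv_mul_bump_le (b := 1 + M) hY hκ (by simp)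
    have h4 : ∑ m ∈ Finset.range M, (((m + 1 : ℕ) : ℝ) + 1)⁻¹
          * bump (Y * (((m + 1 : ℕ) : ℝ) + 1) ^ κ)
        = ∑ i ∈ Finset.range M, (1 + ((i + 1 : ℕ) : ℝ))⁻¹
          * bump (Y * (1 + ((i + 1 : ℕ) : ℝ)) ^ κ) := by
      refine Finset.sum_congr rfl fun i _ => ?_
      rw [add_comm (1 : ℝ)]
    rw [h4]
    linarith

lemma sum_inv_le_one_add_log (M : ℕ) :
    ∑ m ∈ Finset.range M, ((m : ℝ) + 1)⁻¹ ≤ 1 + Real.log M := by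
  have h := harmonic_le_one_add_log M
  simpa [harmonic] using h

lemma partialSum_natCast (f : ℕ+ → ℝ) (M : ℕ) :
    partialSum f M = ∑ m ∈ Finset.range M, f m.succPNat := by
  simp [partialSum]

/-! ### Sums over boxes -/

/-- The box of all `η ∈ ℤ_{>0}^n` with `η i ≤ M i`. -/
def box {n : ℕ} (M : Fin n → ℕ) : Finset (Fin n → ℕ+) :=
  Fintype.piFinset fun i => (Finset.range (M i)).map ⟨Nat.succPNat, Nat.succPNat_injective⟩

lemma mem_box {n : ℕ} {M : Fin n → ℕ} {η : Fin n → ℕ+} :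
    η ∈ box M ↔ ∀ i, (η i : ℕ) ≤ M i := by
  simp only [box, Fintype.mem_piFinset, Finset.mem_map, Finset.mem_range,
    Function.Embedding.coeFn_mk]
  refine forall_congr' fun i => ⟨?_, fun h => ⟨PNat.natPred (η i), ?_, ?_⟩⟩
  · rintro ⟨m, hm, h⟩
    rw [← h, Nat.succPNat_coe]
    omega
  · have := PNat.natPred_add_one (η i)
    omega
  · exact PNat.succPNat_natPred (η i)

lemma sum_box_insertNth {n : ℕ} (i : Fin (n + 1)) (M : Fin (n + 1) → ℕ)
    (F : (Fin (n + 1) → ℕ+) → ℝ) :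
    ∑ η ∈ box M, F η = ∑ η ∈ box (fun i' => M (i.succAbove i')), ∑ m ∈ Finset.range (M i),
      F (Fin.insertNth (α := fun _ => ℕ+) i m.succPNat η) := by
  rw [← Finset.sum_product']
  symm
  refine Finset.sum_bij' (fun x _ => Fin.insertNth (α := fun _ => ℕ+) i x.2.succPNat x.1)
    (fun η _ => (fun i' => η (i.succAbove i'), (η i).natPred)) ?_ ?_ ?_ ?_ ?_
  · rintro ⟨η, m⟩ h
    simp only [Finset.mem_product, mem_box, Finset.mem_range] at h ⊢
    intro i'
    rcases Fin.eq_self_or_eq_succAbove i i' with rfl | ⟨i'', rfl⟩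
    · rw [Fin.insertNth_apply_same, Nat.succPNat_coe]
      omega
    · rw [Fin.insertNth_apply_succAbove]
      exact h.1 i''
  · intro η h
    simp only [Finset.mem_product, mem_box, Finset.mem_range] at h ⊢
    refine ⟨fun i' => h _, ?_⟩
    have := h i
    have := PNat.natPred_add_one (η i)
    omega
  · rintro ⟨η, m⟩ h
    simp
  · intro η h
    simp only [PNat.succPNat_natPred]
    exact Fin.insertNth_self_removeNth i η
  · intro x _
    rfl

lemma sum_box_snoc {n : ℕ} (M : Fin (n + 1) → ℕ) (F : (Fin (n + 1) → ℕ+) → ℝ) :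
    ∑ η ∈ box M, F η = ∑ η ∈ box (fun i => M i.castSucc), ∑ m ∈ Finset.range (M (Fin.last n)),
      F (Fin.snoc (α := fun _ => ℕ+) η m.succPNat) := by
  rw [sum_box_insertNth (Fin.last n)]
  simp only [Fin.succAbove_last, Fin.insertNth_last']

/-! ### Weighted sums of functions in `Θ_{0,n}(C)` -/

lemma log_add_two_rpow_nonneg {t : ℝ} (ht : 0 ≤ t) (C : ℝ) : 0 ≤ Real.log (t + 2) ^ C :=
  Real.rpow_nonneg (Real.log_nonneg (by linarith)) C

lemma sum_mul_le_of_partialSum_le {C c : ℝ} (hC : 0 ≤ C) (hc : 0 ≤ c) {d : ℕ+ → ℝ}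
    (hd : ∀ t : ℝ, 0 ≤ t → partialSum d t ≤ c * (t * Real.log (t + 2) ^ C))
    {g : ℕ → ℝ} (hg : Antitone g) (h0 : ∀ m, 0 ≤ g m) (M : ℕ) :
    ∑ m ∈ Finset.range M, d m.succPNat * g m
      ≤ c * Real.log (M + 2) ^ C * ∑ m ∈ Finset.range M, g m := by
  refine sum_mul_le_of_antitone (d := fun m => d m.succPNat) (fun m hm => ?_) hg h0
  rw [← partialSum_natCast]
  refine (hd m m.cast_nonneg).trans ?_
  rw [mul_assoc, mul_comm (m : ℝ)]
  have h1 : (m : ℝ) ≤ M := by exact_mod_cast hm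
  have h2 : 0 ≤ Real.log ((m : ℝ) + 2) :=
    Real.log_nonneg (by linarith [(Nat.cast_nonneg m : (0 : ℝ) ≤ m)])
  have h3 : Real.log ((m : ℝ) + 2) ≤ Real.log (M + 2) :=
    Real.log_le_log (by positivity) (by linarith)
  gcongr

/-- In the definition of `Θ_{0,n+1}(C)`, the function of the remaining variables can be taken from
`Θ_{0,n}(C)` with non-negative values, also for `n = 0`. -/
lemma exists_sliceBound {C : ℝ} {n : ℕ} {θ : (Fin (n + 1) → ℕ+) → ℝ}
    (hθ : θ ∈ ThetaBound C (n + 1)) (i : Fin (n + 1)) :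
    ∃ θi ∈ ThetaBound C n, (∀ η, 0 ≤ θi η) ∧ ∀ (η : Fin n → ℕ+) (t : ℝ), 0 ≤ t →
      partialSum (fun m => θ (Fin.insertNth (α := fun _ => ℕ+) i m η)) t
        ≤ θi η * (t * Real.log (t + 2) ^ C) := by
  obtain ⟨θi, hi, h⟩ := hθ.2 i
  refine ⟨θi, hi, fun η => ?_, h⟩
  have h1 := h η 1 zero_le_one
  have h2 : 0 ≤ partialSum (fun m => θ (Fin.insertNth (α := fun _ => ℕ+) i m η)) 1 :=
    Finset.sum_nonneg fun m _ => hθ.1 _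
  have h3 : 0 < 1 * Real.log ((1 : ℝ) + 2) ^ C := by
    rw [one_mul]
    exact Real.rpow_pos_of_pos (Real.log_pos (by norm_num)) C
  by_contra hneg
  push Not at hneg
  nlinarith

/-- The product of the inverses of the coordinates. -/
def invProd {n : ℕ} (x : Fin n → ℝ) : ℝ := ∏ i, (x i)⁻¹

lemma invProd_nonneg {n : ℕ} {x : Fin n → ℝ} (hx : ∀ i, 0 < x i) : 0 ≤ invProd x :=
  Finset.prod_nonneg fun i _ => (inv_pos.mpr (hx i)).le

/-- The vector of real numbers underlying a vector of positive integers. -/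
def toReal {n : ℕ} (η : Fin n → ℕ+) : Fin n → ℝ := fun i => ((η i : ℕ) : ℝ)

lemma toReal_pos {n : ℕ} (η : Fin n → ℕ+) (i : Fin n) : 0 < toReal η i := by
  simp [toReal]

lemma invProd_toReal_insertNth {n : ℕ} (i : Fin (n + 1)) (m : ℕ) (η : Fin n → ℕ+) :
    invProd (toReal (Fin.insertNth (α := fun _ => ℕ+) i m.succPNat η))
      = ((m : ℝ) + 1)⁻¹ * invProd (toReal η) := by
  unfold invProd toReal
  rw [Fin.prod_univ_succAbove _ i]
  simp [Fin.insertNth_apply_same, Fin.insertNth_apply_succAbove]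

/-- Summing a function in `Θ_{0,n}(C)` over a box with weight `∏ (η i)⁻¹`, one variable after the
other: each variable costs a logarithm from `∑ 1/m` and a factor from the definition of
`Θ_{0,n}(C)`. -/
lemma exists_sum_invProd_le {C : ℝ} (hC : 0 ≤ C) : ∀ {n : ℕ} {θ : (Fin n → ℕ+) → ℝ},
    θ ∈ ThetaBound C n → ∃ K : ℝ, 0 ≤ K ∧ ∀ (M : Fin n → ℕ) (w : Fin n → ℝ),
      (∀ i, (1 + Real.log (M i)) * Real.log (M i + 2) ^ C ≤ w i) →
      ∑ η ∈ box M, θ η * invProd (toReal η) ≤ K * ∏ i, w i := by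
  intro n
  induction n with
  | zero =>
    intro θ _
    refine ⟨|θ Fin.elim0|, abs_nonneg _, fun M w _ => ?_⟩
    have : box M = {Fin.elim0} := by
      ext η
      simp [mem_box, Subsingleton.elim η Fin.elim0]
    rw [this]
    simp [invProd, le_abs_self]
  | succ n ih =>
    intro θ hθ
    obtain ⟨θ₀, hmem, hpos, hsum⟩ := exists_sliceBound hθ 0
    obtain ⟨K, hK, h⟩ := ih hmem
    refine ⟨K, hK, fun M w hw => ?_⟩
    rw [sum_box_insertNth 0, Fin.prod_univ_succAbove _ 0]
    have h1 : ∀ η ∈ box (fun i' : Fin n => M (Fin.succAbove 0 i')),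
        ∑ m ∈ Finset.range (M 0),
          θ (Fin.insertNth (α := fun _ => ℕ+) 0 m.succPNat η)
            * invProd (toReal (Fin.insertNth (α := fun _ => ℕ+) 0 m.succPNat η))
          ≤ θ₀ η * invProd (toReal η) * w 0 := by
      intro η _
      have hanti : Antitone fun m : ℕ => ((m : ℝ) + 1)⁻¹ := by
        intro a b hab
        have : (a : ℝ) ≤ b := by exact_mod_cast hab
        simp only
        gcongr
      have h2 := sum_mul_le_of_partialSum_le hC (hpos η) (hsum η) hanti
        (fun m => by positivity) (M 0)
      have h3 := invProd_nonneg (toReal_pos η)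
      have h4 : 0 ≤ Real.log ((M 0 : ℝ) + 2) ^ C :=
        log_add_two_rpow_nonneg (Nat.cast_nonneg _) C
      calc _ = (∑ m ∈ Finset.range (M 0), θ (Fin.insertNth (α := fun _ => ℕ+) 0 m.succPNat η)
              * ((m : ℝ) + 1)⁻¹) * invProd (toReal η) := by
            rw [Finset.sum_mul]
            refine Finset.sum_congr rfl fun m _ => ?_
            rw [invProd_toReal_insertNth, mul_assoc]
        _ ≤ (θ₀ η * Real.log (M 0 + 2) ^ C * (1 + Real.log (M 0))) * invProd (toReal η) := by
            gcongr
            refine h2.trans (mul_le_mul_of_nonneg_left (sum_inv_le_one_add_log _) ?_)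
            exact mul_nonneg (hpos η) h4
        _ = θ₀ η * invProd (toReal η) * ((1 + Real.log (M 0)) * Real.log (M 0 + 2) ^ C) := by
            ring
        _ ≤ _ := mul_le_mul_of_nonneg_left (hw 0) (mul_nonneg (hpos η) h3)
    refine (Finset.sum_le_sum h1).trans ?_
    rw [← Finset.sum_mul]
    have hw0 : 0 ≤ w 0 := by
      refine le_trans (mul_nonneg ?_ (log_add_two_rpow_nonneg (Nat.cast_nonneg _) C)) (hw 0)
      linarith [Real.log_natCast_nonneg (M 0)]
    calc _ ≤ (K * ∏ i, w (Fin.succAbove 0 i)) * w 0 :=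
          mul_le_mul_of_nonneg_right (h _ _ fun i => hw _) hw0
      _ = _ := by ring

/-- The monomial `∏ i, x i ^ k i j`. -/
def monomial {n s : ℕ} (k : Fin n → Fin s → ℝ) (j : Fin s) (x : Fin n → ℝ) : ℝ :=
  ∏ i, x i ^ k i j

lemma monomial_pos {n s : ℕ} (k : Fin n → Fin s → ℝ) (j : Fin s) {x : Fin n → ℝ}
    (hx : ∀ i, 0 < x i) : 0 < monomial k j x :=
  Finset.prod_pos fun i _ => Real.rpow_pos_of_pos (hx i) _

lemma monomial_toReal_insertNth {n s : ℕ} (k : Fin (n + 1) → Fin s → ℝ) (j : Fin s)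
    (i : Fin (n + 1)) (m : ℕ) (η : Fin n → ℕ+) :
    monomial k j (toReal (Fin.insertNth (α := fun _ => ℕ+) i m.succPNat η))
      = ((m : ℝ) + 1) ^ k i j * monomial (fun i' => k (i.succAbove i')) j (toReal η) := by
  unfold monomial toReal
  rw [Fin.prod_univ_succAbove _ i]
  simp [Fin.insertNth_apply_same, Fin.insertNth_apply_succAbove]

/-- The weight `∏ j, bump (Y j * ∏ i, x i ^ k i j)`, which takes over the role of the indicator
function of the `s` height conditions. -/
def heightWeight {n s : ℕ} (k : Fin n → Fin s → ℝ) (Y : Fin s → ℝ) (x : Fin n → ℝ) : ℝ :=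
  ∏ j, bump (Y j * monomial k j x)

lemma heightWeight_nonneg {n s : ℕ} (k : Fin n → Fin s → ℝ) {Y : Fin s → ℝ} (hY : ∀ j, 0 < Y j)
    {x : Fin n → ℝ} (hx : ∀ i, 0 < x i) : 0 ≤ heightWeight k Y x :=
  Finset.prod_nonneg fun j _ => bump_nonneg (mul_pos (hY j) (monomial_pos k j hx))

lemma heightWeight_le_one {n s : ℕ} (k : Fin n → Fin s → ℝ) {Y : Fin s → ℝ} (hY : ∀ j, 0 < Y j)
    {x : Fin n → ℝ} (hx : ∀ i, 0 < x i) : heightWeight k Y x ≤ 1 :=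
  Finset.prod_le_one (fun j _ => bump_nonneg (mul_pos (hY j) (monomial_pos k j hx)))
    fun j _ => bump_le_one (mul_pos (hY j) (monomial_pos k j hx))

/-- The exponents `k` are in echelon form with pivots `p`, and bounded by `1`. -/
structure IsPivot {n s : ℕ} (k : Fin n → Fin s → ℝ) (p : Fin s → Fin n) : Prop where
  ne_zero : ∀ j, k (p j) j ≠ 0
  eq_zero : ∀ j j', j' < j → k (p j) j' = 0
  abs_le_one : ∀ i j, |k i j| ≤ 1

lemma IsPivot.injective {n s : ℕ} {k : Fin n → Fin s → ℝ} {p : Fin s → Fin n}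
    (h : IsPivot k p) : Function.Injective p := by
  intro j j' hjj
  rcases lt_trichotomy j j' with hlt | heq | hlt
  · exact absurd (hjj ▸ h.eq_zero j' j hlt) (h.ne_zero j)
  · exact heq
  · exact absurd (hjj ▸ h.eq_zero j j' hlt) (h.ne_zero j')

/-- Summing a function in `Θ_{0,n}(0)` over a box with weight `∏ (η i)⁻¹` costs a factor `w i`
of logarithmic size for each variable which is not a pivot. Each pivot variable costs only a
constant, because its sum converges thanks to the corresponding height condition; this holds
uniformly in the height parameters `Y`. -/
lemma exists_sum_heightWeight_le : ∀ {s n : ℕ} {k : Fin n → Fin s → ℝ} {p : Fin s → Fin n},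
    IsPivot k p → ∀ {θ : (Fin n → ℕ+) → ℝ}, θ ∈ ThetaBound 0 n →
    ∃ K : ℝ, 0 ≤ K ∧ ∀ (M : Fin n → ℕ) (w : Fin n → ℝ), (∀ i, 1 ≤ w i) →
      (∀ i, (∀ j, i ≠ p j) → 1 + Real.log (M i) ≤ w i) → ∀ Y : Fin s → ℝ, (∀ j, 0 < Y j) →
      ∑ η ∈ box M, θ η * (invProd (toReal η) * heightWeight k Y (toReal η)) ≤ K * ∏ i, w i := by
  intro s
  induction s with
  | zero =>
    intro n k p _ θ hθ
    obtain ⟨K, hK, h⟩ := exists_sum_invProd_le le_rfl hθ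
    refine ⟨K, hK, fun M w _ hw Y _ => ?_⟩
    simpa [heightWeight] using h M w fun i => by
      simpa using hw i fun j => j.elim0
  | succ s ih =>
    intro n k p hp θ hθ
    cases n with
    | zero => exact (p 0).elim0
    | succ n =>
      set i := p (Fin.last s) with hi
      have hex : ∀ j : Fin s, ∃ i', i.succAbove i' = p j.castSucc := fun j =>
        Fin.exists_succAbove_eq fun h =>
          (Fin.castSucc_lt_last j).ne (hp.injective h)
      choose p' hp' using hex
      obtain ⟨θi, hmem, hpos, hsum⟩ := exists_sliceBound hθ i
      have hpiv : IsPivot (fun (i' : Fin n) (j : Fin s) => k (i.succAbove i') j.castSucc) p' := by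
        refine ⟨fun j => ?_, fun j j' hj => ?_, fun _ _ => hp.abs_le_one _ _⟩
        · rw [hp']
          exact hp.ne_zero _
        · rw [hp']
          exact hp.eq_zero _ _ (Fin.castSucc_lt_castSucc_iff.mpr hj)
      obtain ⟨K, hK, h⟩ := ih hpiv hmem
      have hκ0 : k i (Fin.last s) ≠ 0 := hp.ne_zero _
      have hκ1 := hp.abs_le_one i (Fin.last s)
      set D := 1 + Real.pi / |k i (Fin.last s)| with hD
      have hD0 : 0 ≤ D := by positivity
      refine ⟨K * D, mul_nonneg hK hD0, fun M w hw1 hw Y hY => ?_⟩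
      rw [sum_box_insertNth i]
      have h1 : ∀ η ∈ box (fun i' : Fin n => M (i.succAbove i')),
          ∑ m ∈ Finset.range (M i),
            θ (Fin.insertNth (α := fun _ => ℕ+) i m.succPNat η)
              * (invProd (toReal (Fin.insertNth (α := fun _ => ℕ+) i m.succPNat η))
                * heightWeight k Y (toReal (Fin.insertNth (α := fun _ => ℕ+) i m.succPNat η)))
          ≤ θi η * (invProd (toReal η) * heightWeight
              (fun (i' : Fin n) (j : Fin s) => k (i.succAbove i') j.castSucc)
              (fun j => Y j.castSucc) (toReal η)) * D := by
        intro η _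
        set Z := Y (Fin.last s) * monomial (fun i' => k (i.succAbove i')) (Fin.last s) (toReal η)
          with hZdef
        have hZ : 0 < Z := mul_pos (hY _) (monomial_pos _ _ (toReal_pos η))
        set W := invProd (toReal η) * heightWeight
              (fun (i' : Fin n) (j : Fin s) => k (i.succAbove i') j.castSucc)
              (fun j => Y j.castSucc) (toReal η) with hWdef
        have hW : 0 ≤ W := mul_nonneg (invProd_nonneg (toReal_pos η))
          (heightWeight_nonneg _ (fun j => hY _) (toReal_pos η))
        have hterm : ∀ m : ℕ,
            invProd (toReal (Fin.insertNth (α := fun _ => ℕ+) i m.succPNat η))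
              * heightWeight k Y (toReal (Fin.insertNth (α := fun _ => ℕ+) i m.succPNat η))
            = ((m : ℝ) + 1)⁻¹ * bump (Z * ((m : ℝ) + 1) ^ k i (Fin.last s)) * W := by
          intro m
          rw [invProd_toReal_insertNth, heightWeight, Fin.prod_univ_castSucc,
            monomial_toReal_insertNth]
          have : ∀ j : Fin s, monomial k j.castSucc
              (toReal (Fin.insertNth (α := fun _ => ℕ+) i m.succPNat η))
              = monomial (fun (i' : Fin n) (j : Fin s) => k (i.succAbove i') j.castSucc) j
                (toReal η) := by
            intro j
            rw [monomial_toReal_insertNth, hp.eq_zero _ _ (Fin.castSucc_lt_last j),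
              Real.rpow_zero, one_mul]
            rfl
          simp only [this]
          rw [hWdef, heightWeight, hZdef,
            show Y (Fin.last s) * (((m : ℝ) + 1) ^ k i (Fin.last s)
              * monomial (fun i' => k (i.succAbove i')) (Fin.last s) (toReal η))
              = Y (Fin.last s) * monomial (fun i' => k (i.succAbove i')) (Fin.last s) (toReal η)
                * ((m : ℝ) + 1) ^ k i (Fin.last s) by ring]
          ring
        have h2 := sum_mul_le_of_partialSum_le le_rfl (hpos η) (hsum η)
          (antitone_nat_inv_mul_bump hZ hκ1)
          (fun m => mul_nonneg (by positivity) (bump_nonneg (by positivity))) (M i)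
        rw [Real.rpow_zero, mul_one] at h2
        calc _ = (∑ m ∈ Finset.range (M i),
                θ (Fin.insertNth (α := fun _ => ℕ+) i m.succPNat η)
                * (((m : ℝ) + 1)⁻¹ * bump (Z * ((m : ℝ) + 1) ^ k i (Fin.last s)))) * W := by
              rw [Finset.sum_mul]
              refine Finset.sum_congr rfl fun m _ => ?_
              rw [hterm]
              ring
          _ ≤ (θi η * D) * W := by
              gcongr
              exact h2.trans (mul_le_mul_of_nonneg_left (sum_inv_mul_bump_le hZ hκ0 hκ1 _)
                (hpos η))
          _ = _ := by ring
      refine (Finset.sum_le_sum h1).trans ?_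
      rw [← Finset.sum_mul, Fin.prod_univ_succAbove _ i]
      have h3 := h (fun i' => M (i.succAbove i')) (fun i' => w (i.succAbove i')) (fun _ => hw1 _)
        (fun i' hi' => hw _ fun j => by
          rcases Fin.eq_castSucc_or_eq_last j with ⟨j, rfl⟩ | rfl
          · rw [← hp']
            exact fun h => hi' j (Fin.succAbove_right_injective h)
          · exact Fin.succAbove_ne _ _) (fun j => Y j.castSucc) (fun _ => hY _)
      have h4 : 0 ≤ ∏ i', w (i.succAbove i') :=
        Finset.prod_nonneg fun i' _ => zero_le_one.trans (hw1 _)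
      calc _ ≤ (K * ∏ i', w (i.succAbove i')) * D := mul_le_mul_of_nonneg_right h3 hD0
        _ = K * D * (1 * ∏ i', w (i.succAbove i')) := by ring
        _ ≤ _ := by
          gcongr
          exact hw1 i

/-! ### Comparison of a sum in one variable with an integral -/

lemma average_spec {C : ℝ} {θ : ℕ+ → ℝ} (h : ∃ c, IsAverage C θ c) :
    IsAverage C θ (average C θ) := by
  unfold average
  rw [dif_pos h]
  exact h.choose_spec

lemma errorSup_nonneg (C : ℝ) (θ : ℕ+ → ℝ) : 0 ≤ errorSup C θ := by
  refine Real.sSup_nonneg ?_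
  rintro _ ⟨t, _, rfl⟩
  exact abs_nonneg _

lemma abs_partialSum_sub_average_le {C : ℝ} {θ : ℕ+ → ℝ} (h : ∃ c, IsAverage C θ c) {t : ℝ}
    (ht : 0 ≤ t) :
    |partialSum θ t - average C θ * t| ≤ errorSup C θ * Real.log (t + 2) ^ C := by
  obtain ⟨-, E, ⟨M, hM⟩, hE⟩ := average_spec h
  have hpos : ∀ u : ℝ, 0 ≤ u → 0 < Real.log (u + 2) ^ C := fun u hu =>
    Real.rpow_pos_of_pos (Real.log_pos (by linarith)) C
  have heq : ∀ u : ℝ, 0 ≤ u →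
      (partialSum θ u - average C θ * u) / Real.log (u + 2) ^ C = E u := by
    intro u hu
    rw [hE u hu, add_sub_cancel_left, mul_div_assoc, div_self (hpos u hu).ne', mul_one]
  have hb : |(partialSum θ t - average C θ * t) / Real.log (t + 2) ^ C| ≤ errorSup C θ := by
    refine le_csSup ⟨M, ?_⟩ ⟨t, ht, rfl⟩
    rintro _ ⟨u, hu, rfl⟩
    simp only
    rw [heq u hu]
    exact hM u hu
  rwa [abs_div, abs_of_pos (hpos t ht), div_le_iff₀ (hpos t ht)] at hb

/-- A `C¹` function on a closed interval is the restriction of a `C¹` function on the line. -/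
lemma exists_contDiff_extension {a b : ℝ} (hab : a < b) {f : ℝ → ℝ}
    (hf : ContDiffOn ℝ 1 f (Set.Icc a b)) :
    ∃ F g : ℝ → ℝ, Continuous g ∧ (∀ x, HasDerivAt F (g x) x) ∧
      ∀ x ∈ Set.Icc a b, F x = f x ∧ g x = derivWithin f (Set.Icc a b) x := by
  have hg := hf.continuousOn_derivWithin (uniqueDiffOn_Icc hab) le_rfl
  set g : ℝ → ℝ := Set.IccExtend hab.le
    (Set.domRestrict (Set.Icc a b) (derivWithin f (Set.Icc a b))) with hgdef
  have hgc : Continuous g := hg.domRestrict.Icc_extend'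
  have hge : ∀ x ∈ Set.Icc a b, g x = derivWithin f (Set.Icc a b) x := fun x hx => by
    rw [hgdef, Set.IccExtend_of_mem hab.le _ hx]
    rfl
  refine ⟨fun x => f a + ∫ t in a..x, g t, g, hgc, fun x => ?_, fun x hx => ⟨?_, hge x hx⟩⟩
  · exact (intervalIntegral.integral_hasDerivAt_right (hgc.intervalIntegrable _ _)
      (hgc.stronglyMeasurableAtFilter _ _) hgc.continuousAt).const_add _
  · have h := intervalIntegral.integral_eq_sub_of_hasDeriv_right_of_le (f := f) (f' := g) hx.1
      (hf.continuousOn.mono (Set.Icc_subset_Icc_right hx.2)) (fun y hy => ?_)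
      (hgc.intervalIntegrable _ _)
    · simp only
      rw [h]
      ring
    · have hy' : y ∈ Set.Icc a b := ⟨hy.1.le, hy.2.le.trans hx.2⟩
      rw [hge y hy']
      have h1 := (hf.differentiableOn one_ne_zero y hy').hasDerivWithinAt
      exact (h1.hasDerivAt (Icc_mem_nhds hy.1 (hy.2.trans_le hx.2))).hasDerivWithinAt

/-- A bounded non-negative function whose derivative changes sign at most `N` times has total
variation at most `N + 1` times its bound. -/
lemma integral_abs_deriv_le {a b T S : ℝ} {N : ℕ} {f F g : ℝ → ℝ} (haT : a ≤ T) (hTb : T ≤ b)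
    (hf : HasFewSignChanges N a b f) (hg : Continuous g) (hF : ∀ x, HasDerivAt F (g x) x)
    (hFg : ∀ x ∈ Set.Icc a b, F x = f x ∧ g x = derivWithin f (Set.Icc a b) x)
    (h0 : ∀ x ∈ Set.Icc T b, 0 ≤ f x) (hS : ∀ x ∈ Set.Icc T b, f x ≤ S) :
    ∫ x in T..b, |g x| ≤ (N + 1) * S := by
  obtain ⟨-, t, hmono, ht0, ht1, hsign⟩ := hf
  have hS0 : 0 ≤ S := (h0 b ⟨hTb, le_rfl⟩).trans (hS b ⟨hTb, le_rfl⟩)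
  set u : ℕ → ℝ := fun i => max T (t ⟨min i (N + 1), by omega⟩) with hu
  have hu0 : u 0 = T := by
    have : (⟨min 0 (N + 1), by omega⟩ : Fin (N + 2)) = 0 := by ext; simp
    simp only [hu, this, ht0, max_eq_left haT]
  have hu1 : u (N + 1) = b := by
    have : (⟨min (N + 1) (N + 1), by omega⟩ : Fin (N + 2)) = Fin.last (N + 1) := by ext; simp
    simp only [hu, this, ht1, max_eq_right hTb]
  have humono : Monotone u := fun i j hij => by
    simp only [hu]
    refine max_le_max le_rfl (hmono ?_)
    rw [Fin.mk_le_mk]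
    omega
  have hsum := intervalIntegral.sum_integral_adjacent_intervals (f := fun x => |g x|)
    (μ := volume) (a := u) (n := N + 1) fun k _ => hg.abs.intervalIntegrable _ _
  rw [hu0, hu1] at hsum
  rw [← hsum]
  have hpiece : ∀ i ∈ Finset.range (N + 1), ∫ x in u i..u (i + 1), |g x| ≤ S := by
    intro i hi
    rw [Finset.mem_range] at hi
    have hle := humono (Nat.le_succ i)
    have hT' : T ≤ u i := le_max_left _ _
    have hb' : u (i + 1) ≤ b := hu1 ▸ humono (by omega : i + 1 ≤ N + 1)
    have hmem : ∀ x ∈ Set.Icc (u i) (u (i + 1)), x ∈ Set.Icc T b := fun x hx =>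
      ⟨hT'.trans hx.1, hx.2.trans hb'⟩
    have hmem' : ∀ x ∈ Set.Icc T b, x ∈ Set.Icc a b := fun x hx => ⟨haT.trans hx.1, hx.2⟩
    have hFTC : ∫ x in u i..u (i + 1), g x = f (u (i + 1)) - f (u i) := by
      rw [intervalIntegral.integral_eq_sub_of_hasDerivAt (fun x _ => hF x)
        (hg.intervalIntegrable _ _), (hFg _ (hmem' _ (hmem _ ⟨hle, le_rfl⟩))).1,
        (hFg _ (hmem' _ (hmem _ ⟨le_rfl, hle⟩))).1]
    have e1 := h0 _ (hmem _ ⟨hle, le_rfl⟩)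
    have e2 := h0 _ (hmem _ ⟨le_rfl, hle⟩)
    have e3 := hS _ (hmem _ ⟨hle, le_rfl⟩)
    have e4 := hS _ (hmem _ ⟨le_rfl, hle⟩)
    rcases hle.eq_or_lt with heq | hlt
    · rw [← heq, intervalIntegral.integral_same]
      exact hS0
    -- A nondegenerate piece lies inside the corresponding piece of the given partition.
    have hsub : ∀ x ∈ Set.Icc (u i) (u (i + 1)),
        x ∈ Set.Icc (t (⟨i, hi⟩ : Fin (N + 1)).castSucc) (t (⟨i, hi⟩ : Fin (N + 1)).succ) := by
      have h1 : (⟨min i (N + 1), by omega⟩ : Fin (N + 2)) = (⟨i, hi⟩ : Fin (N + 1)).castSucc := by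
        ext; simp; omega
      have h2 : (⟨min (i + 1) (N + 1), by omega⟩ : Fin (N + 2)) = (⟨i, hi⟩ : Fin (N + 1)).succ := by
        ext; simp; omega
      have h3 : u (i + 1) = t (⟨i, hi⟩ : Fin (N + 1)).succ := by
        have : u (i + 1) = max T (t (⟨i, hi⟩ : Fin (N + 1)).succ) := by simp only [hu, h2]
        rcases max_cases T (t (⟨i, hi⟩ : Fin (N + 1)).succ) with h | h
        · exact absurd (this.trans h.1) (by linarith [hT'.trans_lt hlt])
        · exact this.trans h.1
      have h4 : t (⟨i, hi⟩ : Fin (N + 1)).castSucc ≤ u i := by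
        simp only [hu, h1]
        exact le_max_right _ _
      exact fun x hx => ⟨h4.trans hx.1, hx.2.trans h3.le⟩
    rcases hsign ⟨i, hi⟩ with hs | hs
    · have : ∫ x in u i..u (i + 1), |g x| = ∫ x in u i..u (i + 1), g x := by
        refine intervalIntegral.integral_congr fun x hx => ?_
        rw [Set.uIcc_of_le hle] at hx
        refine abs_of_nonneg ?_
        rw [(hFg x (hmem' x (hmem x hx))).2]
        exact hs x (hsub x hx)
      rw [this, hFTC]
      linarith
    · have : ∫ x in u i..u (i + 1), |g x| = ∫ x in u i..u (i + 1), -g x := by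
        refine intervalIntegral.integral_congr fun x hx => ?_
        rw [Set.uIcc_of_le hle] at hx
        refine abs_of_nonpos ?_
        rw [(hFg x (hmem' x (hmem x hx))).2]
        exact hs x (hsub x hx)
      rw [this, intervalIntegral.integral_neg, hFTC]
      linarith
  refine (Finset.sum_le_sum hpiece).trans ?_
  simp

lemma sum_Icc_eq_partialSum (θ : ℕ+ → ℝ) (t : ℝ) :
    ∑ k ∈ Finset.Icc 0 ⌊t⌋₊, (if k = 0 then 0 else θ (k - 1).succPNat) = partialSum θ t := by
  rw [← Nat.range_succ_eq_Icc_zero, Finset.sum_range_succ']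
  simp [partialSum]

/-- If the partial sums of `θ` are `c t` up to an error of at most `R`, and if `f` takes values in
`[0, S]` on `[T, B]` and has few sign changes, then `∑ θ f` over `(T, B]` is `c ∫ f` up to an error
of order `S R`. -/
lemma abs_sum_sub_integral_le {θ : ℕ+ → ℝ} {c R B T S : ℝ} {N : ℕ} {f : ℝ → ℝ} (hB : 1 < B)
    (hT : 1 ≤ T) (hTB : T ≤ B) (hf : HasFewSignChanges N 1 B f)
    (h0 : ∀ t ∈ Set.Icc T B, 0 ≤ f t) (hS : ∀ t ∈ Set.Icc T B, f t ≤ S)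
    (hθ : ∀ t ∈ Set.Icc T B, |partialSum θ t - c * t| ≤ R) :
    |∑ m ∈ Finset.Ico ⌊T⌋₊ ⌊B⌋₊, θ m.succPNat * f ((m : ℝ) + 1) - c * ∫ t in T..B, f t|
      ≤ (N + 3) * S * R := by
  obtain ⟨F, g, hg, hF, hFg⟩ := exists_contDiff_extension hB hf.1
  have hmem : ∀ x ∈ Set.Icc T B, x ∈ Set.Icc 1 B := fun x hx => ⟨hT.trans hx.1, hx.2⟩
  have hvar := integral_abs_deriv_le hT hTB hf hg hF hFg h0 hS
  have hderiv : deriv F = g := funext fun x => (hF x).deriv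
  have hR : 0 ≤ R := (abs_nonneg _).trans (hθ T ⟨le_rfl, hTB⟩)
  have habel := sum_mul_eq_sub_sub_integral_mul (𝕜 := ℝ)
    (fun k => if k = 0 then 0 else θ (k - 1).succPNat) (f := F) (zero_le_one.trans hT) hTB
    (fun t _ => (hF t).differentiableAt)
    (by rw [hderiv]; exact hg.continuousOn.integrableOn_Icc)
  simp only [sum_Icc_eq_partialSum, hderiv] at habel
  have hint := integrableOn_mul_sum_Icc (𝕜 := ℝ)
    (fun k => if k = 0 then 0 else θ (k - 1).succPNat) (m := 0) (zero_le_one.trans hT)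
    (hg.continuousOn.integrableOn_Icc (μ := volume) (a := T) (b := B))
  simp only [sum_Icc_eq_partialSum] at hint
  have hint' : IntervalIntegrable (fun t => g t * partialSum θ t) volume T B :=
    (intervalIntegrable_iff_integrableOn_Icc_of_le hTB).mpr hint
  have hsum : ∑ k ∈ Finset.Ioc ⌊T⌋₊ ⌊B⌋₊, F k * (if k = 0 then 0 else θ (k - 1).succPNat)
      = ∑ m ∈ Finset.Ico ⌊T⌋₊ ⌊B⌋₊, θ m.succPNat * f ((m : ℝ) + 1) := by
    rw [← Finset.Ico_add_one_add_one_eq_Ioc, ← Finset.sum_Ico_add']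
    refine Finset.sum_congr rfl fun m hm => ?_
    rw [Finset.mem_Ico] at hm
    have h1 : ((m + 1 : ℕ) : ℝ) ∈ Set.Icc T B := by
      constructor
      · exact ((Nat.floor_lt (zero_le_one.trans hT)).mp (by omega)).le
      · exact (Nat.le_floor_iff (by linarith)).mp (by omega)
    rw [(hFg _ (hmem _ h1)).1, if_neg (by omega), Nat.add_sub_cancel, mul_comm, Nat.cast_succ]
  have hparts := intervalIntegral.integral_mul_deriv_eq_deriv_mul (a := T) (b := B) (u := F)
    (v := fun x => x) (u' := g) (v' := fun _ => 1) (fun x _ => hF x) (fun x _ => hasDerivAt_id x)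
    (hg.intervalIntegrable _ _) (continuous_const.intervalIntegrable _ _)
  have hFf : ∫ x in T..B, F x * 1 = ∫ t in T..B, f t := by
    refine intervalIntegral.integral_congr fun x hx => ?_
    rw [Set.uIcc_of_le hTB] at hx
    simp only [mul_one]
    exact (hFg x (hmem x hx)).1
  have hsub : ∫ t in T..B, g t * (partialSum θ t - c * t)
      = (∫ t in T..B, g t * partialSum θ t) - c * ∫ t in T..B, g t * t := by
    rw [← intervalIntegral.integral_const_mul, ← intervalIntegral.integral_sub hint'
      (Continuous.intervalIntegrable (by fun_prop) _ _)]
    exact intervalIntegral.integral_congr fun x _ => by ring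
  have hbound : |∫ t in T..B, g t * (partialSum θ t - c * t)| ≤ (N + 1) * S * R := by
    have h1 : ‖∫ t in T..B, g t * (partialSum θ t - c * t)‖ ≤ ∫ t in T..B, |g t| * R := by
      refine intervalIntegral.norm_integral_le_of_norm_le hTB ?_
        ((hg.abs.mul continuous_const).intervalIntegrable _ _)
      refine Filter.Eventually.of_forall fun t ht => ?_
      rw [Real.norm_eq_abs, abs_mul]
      exact mul_le_mul_of_nonneg_left (hθ t ⟨ht.1.le, ht.2⟩) (abs_nonneg _)
    rw [intervalIntegral.integral_mul_const] at h1
    exact h1.trans (mul_le_mul_of_nonneg_right hvar hR)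
  have hend : ∀ t ∈ Set.Icc T B, |F t * (partialSum θ t - c * t)| ≤ S * R := fun t ht => by
    rw [(hFg t (hmem t ht)).1, abs_mul, abs_of_nonneg (h0 t ht)]
    exact mul_le_mul (hS t ht) (hθ t ht) (abs_nonneg _) ((h0 t ht).trans (hS t ht))
  have hrepr : ∑ m ∈ Finset.Ico ⌊T⌋₊ ⌊B⌋₊, θ m.succPNat * f ((m : ℝ) + 1) - c * ∫ t in T..B, f t
      = F B * (partialSum θ B - c * B) - F T * (partialSum θ T - c * T)
        - ∫ t in T..B, g t * (partialSum θ t - c * t) := by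
    rw [← hsum, habel, ← intervalIntegral.integral_of_le hTB, hsub, ← hFf, hparts]
    ring
  rw [hrepr]
  refine (abs_sub _ _).trans ?_
  have h1 := abs_sub (F B * (partialSum θ B - c * B)) (F T * (partialSum θ T - c * T))
  have h2 := hend B ⟨hTB, le_rfl⟩
  have h3 := hend T ⟨le_rfl, hTB⟩
  linarith

/-! ### Logarithms of the height -/

lemma one_lt_log_three : 1 < Real.log 3 := by
  rw [Real.lt_log_iff_exp_lt (by norm_num)]
  exact Real.exp_one_lt_three

lemma one_le_log {B : ℝ} (hB : 3 ≤ B) : 1 ≤ Real.log B :=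
  one_lt_log_three.le.trans (Real.log_le_log (by norm_num) hB)

lemma log_log_three_pos : 0 < Real.log (Real.log 3) := Real.log_pos one_lt_log_three

lemma log_log_three_le {B : ℝ} (hB : 3 ≤ B) :
    Real.log (Real.log 3) ≤ Real.log (Real.log B) :=
  Real.log_le_log (zero_lt_one.trans one_lt_log_three) (Real.log_le_log (by norm_num) hB)

lemma one_add_log_floor_le {T : ℝ} (hT : 1 ≤ T) :
    1 + Real.log (⌊T⌋₊ : ℝ) ≤ 1 + Real.log T := by
  have h : (1 : ℝ) ≤ (⌊T⌋₊ : ℝ) := by exact_mod_cast (Nat.one_le_floor_iff T).mpr hT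
  have := Real.log_le_log (by linarith) (Nat.floor_le (zero_le_one.trans hT))
  linarith

lemma log_add_two_le {B : ℝ} (hB : 3 ≤ B) : Real.log (B + 2) ≤ 2 * Real.log B := by
  have h : B + 2 ≤ B ^ 2 := by nlinarith
  have := Real.log_le_log (by linarith) h
  rwa [Real.log_pow, Nat.cast_ofNat] at this

lemma exists_log_rpow_le {D : ℝ} (hD : 0 < D) :
    ∃ K : ℝ, 1 ≤ K ∧ ∀ B : ℝ, 3 ≤ B → Real.log B ^ D ≤ K * B := by
  refine ⟨max 1 (D ^ D), le_max_left _ _, fun B hB => ?_⟩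
  have hB0 : 0 ≤ B := by linarith
  have h := Real.log_le_rpow_div hB0 (inv_pos.mpr hD)
  rw [div_inv_eq_mul] at h
  calc Real.log B ^ D ≤ (B ^ D⁻¹ * D) ^ D :=
        Real.rpow_le_rpow (zero_le_one.trans (one_le_log hB)) h hD.le
    _ = B * D ^ D := by
        rw [Real.mul_rpow (Real.rpow_nonneg hB0 _) hD.le, ← Real.rpow_mul hB0,
          inv_mul_cancel₀ hD.ne', Real.rpow_one]
    _ ≤ _ := by
        rw [mul_comm]
        gcongr
        exact le_max_right _ _

/-! ### One summation -/

lemma snoc_pos {n : ℕ} {x : Fin n → ℝ} (hx : ∀ i, 0 < x i) {t : ℝ} (ht : 0 < t) (i : Fin (n + 1)) :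
    0 < Fin.snoc (α := fun _ => ℝ) x t i := by
  refine Fin.lastCases ?_ (fun i => ?_) i
  · rwa [Fin.snoc_last]
  · rw [Fin.snoc_castSucc]
    exact hx i

lemma snoc_nonneg {n : ℕ} {x : Fin n → ℝ} (hx : ∀ i, 0 ≤ x i) {t : ℝ} (ht : 0 ≤ t)
    (i : Fin (n + 1)) : 0 ≤ Fin.snoc (α := fun _ => ℝ) x t i := by
  refine Fin.lastCases ?_ (fun i => ?_) i
  · rwa [Fin.snoc_last]
  · rw [Fin.snoc_castSucc]
    exact hx i

lemma toReal_snoc {n : ℕ} (η : Fin n → ℕ+) (m : ℕ) :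
    toReal (Fin.snoc (α := fun _ => ℕ+) η m.succPNat)
      = Fin.snoc (α := fun _ => ℝ) (toReal η) ((m : ℝ) + 1) := by
  funext i
  refine Fin.lastCases ?_ (fun i => ?_) i
  · simp [toReal]
  · simp [toReal]

lemma invProd_snoc {n : ℕ} (x : Fin n → ℝ) (t : ℝ) :
    invProd (Fin.snoc (α := fun _ => ℝ) x t) = invProd x * t⁻¹ := by
  simp [invProd, Fin.prod_univ_castSucc, mul_comm]

lemma monomial_snoc {n s : ℕ} (k : Fin (n + 1) → Fin s → ℝ) (j : Fin s) (x : Fin n → ℝ) (t : ℝ) :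
    monomial k j (Fin.snoc (α := fun _ => ℝ) x t)
      = monomial (fun i => k i.castSucc) j x * t ^ k (Fin.last n) j := by
  simp [monomial, Fin.prod_univ_castSucc]

lemma heightWeight_snoc {n s : ℕ} (k : Fin (n + 1) → Fin s → ℝ) (Y : Fin s → ℝ) (x : Fin n → ℝ)
    (t : ℝ) :
    heightWeight k Y (Fin.snoc (α := fun _ => ℝ) x t)
      = heightWeight (fun i => k i.castSucc) (fun j => Y j * t ^ k (Fin.last n) j) x := by
  unfold heightWeight
  refine Finset.prod_congr rfl fun j _ => ?_
  rw [monomial_snoc]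
  congr 1
  ring

/-- A function `V(η₁, …, ηₙ; B)` with the properties of a volume function that are preserved when
its last variable is integrated out. There are `s` height conditions with exponents `k`, entering
through the weights `bump (B ^ (-ε) * ∏ i, η i ^ k i j)`, and the bound contains an additional
factor `(log B)^q`. -/
structure IsControlled {n s : ℕ} (q : ℕ) (k : Fin n → Fin s → ℝ) (ε : ℝ)
    (V : (Fin n → ℝ) → ℝ → ℝ) : Prop where
  nonneg : ∀ B : ℝ, 3 ≤ B → ∀ η : Fin n → ℝ, (∀ i, 0 ≤ η i) → 0 ≤ V η B
  range : ∀ B : ℝ, 3 ≤ B → ∀ η : Fin n → ℝ, (∀ i, 0 ≤ η i) → V η B ≠ 0 →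
    ∀ i, 1 ≤ η i ∧ η i ≤ B
  regular : ∃ N : ℕ, IteratedFewSignChanges N n V
  bound : ∃ K : ℝ, 0 ≤ K ∧ ∀ B : ℝ, 3 ≤ B → ∀ η : Fin n → ℝ, (∀ i, 0 < η i) →
    V η B ≤ K * (B * Real.log B ^ q) * (invProd η * heightWeight k (fun _ => B ^ (-ε)) η)

lemma IsControlled.lastIntegral_eq {n s q : ℕ} {k : Fin (n + 1) → Fin s → ℝ} {ε : ℝ}
    {V : (Fin (n + 1) → ℝ) → ℝ → ℝ} (hV : IsControlled q k ε V) {B : ℝ} (hB : 3 ≤ B)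
    {x : Fin n → ℝ} (hx : ∀ i, 0 ≤ x i) :
    lastIntegral V x B = ∫ t in (1 : ℝ)..B, V (Fin.snoc (α := fun _ => ℝ) x t) B := by
  unfold lastIntegral
  rw [intervalIntegral.integral_of_le (by linarith), ← integral_Icc_eq_integral_Ioc]
  refine setIntegral_eq_of_subset_of_forall_sdiff_eq_zero measurableSet_Ici
    (fun t ht => zero_le_one.trans ht.1) fun t ht => ?_
  by_contra hne
  have h := hV.range B hB _ (snoc_nonneg hx ht.1) hne (Fin.last n)
  rw [Fin.snoc_last] at h
  exact ht.2 h

lemma prod_ite_range {n s : ℕ} {p : Fin s → Fin n} (hp : Function.Injective p) (b : ℝ)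
    [DecidablePred fun i => ∃ j, i = p j] :
    ∏ i, (if ∃ j, i = p j then 1 else b) = b ^ (n - s) := by
  classical
  rw [Finset.prod_ite, Finset.prod_const_one, one_mul, Finset.prod_const]
  congr 1
  have h1 : (Finset.univ.filter fun i => ¬ ∃ j, i = p j) = (Finset.univ.image p)ᶜ := by
    ext i
    simp [eq_comm]
  rw [h1, Finset.card_compl, Finset.card_image_of_injective _ hp]
  simp

/-- The pivots keep their role when the last variable is not a pivot and is dropped. -/
lemma IsPivot.castSucc {n s : ℕ} {k : Fin (n + 1) → Fin s → ℝ} {p : Fin s → Fin n}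
    (hp : IsPivot k fun j => (p j).castSucc) : IsPivot (fun i => k i.castSucc) p :=
  ⟨hp.ne_zero, hp.eq_zero, fun _ _ => hp.abs_le_one _ _⟩

/-- Terms with a small last variable: since no pivot is the last variable, all height conditions
are used up by the other variables. -/
lemma exists_sum_small_le {n s q : ℕ} {k : Fin (n + 1) → Fin s → ℝ} {ε : ℝ}
    {V : (Fin (n + 1) → ℝ) → ℝ → ℝ} (hV : IsControlled q k ε V) {p : Fin s → Fin n}
    (hp : IsPivot k fun j => (p j).castSucc) {θ : (Fin (n + 1) → ℕ+) → ℝ}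
    (hθ : θ ∈ ThetaBound 0 (n + 1)) :
    ∃ K : ℝ, 0 ≤ K ∧ ∀ B : ℝ, 3 ≤ B → ∀ T : ℝ, 1 ≤ T →
      ∑ η ∈ box (fun _ : Fin n => ⌊B⌋₊), ∑ m ∈ Finset.range ⌊T⌋₊,
        θ (Fin.snoc (α := fun _ => ℕ+) η m.succPNat)
          * V (Fin.snoc (α := fun _ => ℝ) (toReal η) ((m : ℝ) + 1)) B
      ≤ K * (B * Real.log B ^ (q + (n - s))) * (1 + Real.log T) := by
  classical
  obtain ⟨K₁, hK₁, h₁⟩ := hV.bound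
  obtain ⟨K₂, hK₂, h₂⟩ := exists_sum_heightWeight_le hp hθ
  refine ⟨K₁ * K₂ * 2 ^ (n - s), by positivity, fun B hB T hT => ?_⟩
  have hL := one_le_log hB
  have hlT := Real.log_nonneg hT
  have hB0 : 0 < B := by linarith
  set M : Fin (n + 1) → ℕ := Fin.snoc (α := fun _ => ℕ) (fun _ => ⌊B⌋₊) ⌊T⌋₊ with hM
  set w : Fin (n + 1) → ℝ := Fin.snoc (α := fun _ => ℝ)
    (fun i => if ∃ j, i = p j then 1 else 1 + Real.log B) (1 + Real.log T) with hw
  have hsum := sum_box_snoc M fun η => θ η * V (toReal η) B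
  simp only [hM, Fin.snoc_castSucc, Fin.snoc_last, toReal_snoc] at hsum
  rw [← hsum, ← hM]
  have hG := h₂ M w ?_ ?_ (fun _ => B ^ (-ε)) (fun _ => Real.rpow_pos_of_pos hB0 _)
  · calc _ ≤ ∑ η ∈ box M, K₁ * (B * Real.log B ^ q) *
          (θ η * (invProd (toReal η) * heightWeight k (fun _ => B ^ (-ε)) (toReal η))) := by
          refine Finset.sum_le_sum fun η _ => ?_
          calc _ ≤ θ η * (K₁ * (B * Real.log B ^ q) *
                (invProd (toReal η) * heightWeight k (fun _ => B ^ (-ε)) (toReal η))) :=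
                mul_le_mul_of_nonneg_left (h₁ B hB _ (toReal_pos η)) (hθ.1 η)
            _ = _ := by ring
      _ ≤ K₁ * (B * Real.log B ^ q) * (K₂ * ∏ i, w i) := by
          rw [← Finset.mul_sum]
          exact mul_le_mul_of_nonneg_left hG (by positivity)
      _ = K₁ * (B * Real.log B ^ q) * (K₂ * ((1 + Real.log B) ^ (n - s) * (1 + Real.log T))) := by
          rw [Fin.prod_univ_castSucc]
          simp only [hw, Fin.snoc_castSucc, Fin.snoc_last]
          rw [prod_ite_range hp.castSucc.injective]
      _ ≤ K₁ * (B * Real.log B ^ q) *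
          (K₂ * ((2 * Real.log B) ^ (n - s) * (1 + Real.log T))) := by
          gcongr
          linarith
      _ = _ := by
          rw [mul_pow, pow_add]
          ring
  · intro i
    refine Fin.lastCases ?_ (fun i => ?_) i
    · simp only [hw, Fin.snoc_last]
      linarith
    · simp only [hw, Fin.snoc_castSucc]
      split_ifs <;> linarith
  · intro i
    refine Fin.lastCases ?_ (fun i => ?_) i
    · intro _
      simp only [hw, hM, Fin.snoc_last]
      exact one_add_log_floor_le hT
    · intro hi
      simp only [hw, hM, Fin.snoc_castSucc]
      rw [if_neg]
      · exact one_add_log_floor_le (by linarith)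
      · rintro ⟨j, rfl⟩
        exact hi j rfl

/-- The part of the integral over a small last variable, summed over the other variables. -/
lemma exists_integral_small_le {n s q : ℕ} {k : Fin (n + 1) → Fin s → ℝ} {ε : ℝ}
    {V : (Fin (n + 1) → ℝ) → ℝ → ℝ} (hV : IsControlled q k ε V) {p : Fin s → Fin n}
    (hp : IsPivot k fun j => (p j).castSucc) {θ : (Fin n → ℕ+) → ℝ}
    (hθ : θ ∈ ThetaBound 0 n) (hθ0 : ∀ η, 0 ≤ θ η) :
    ∃ K : ℝ, 0 ≤ K ∧ ∀ B : ℝ, 3 ≤ B → ∀ T : ℝ, 1 ≤ T → T ≤ B →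
      ∑ η ∈ box (fun _ : Fin n => ⌊B⌋₊), θ η *
        ∫ t in (1 : ℝ)..T, V (Fin.snoc (α := fun _ => ℝ) (toReal η) t) B
      ≤ K * (B * Real.log B ^ (q + (n - s))) * (1 + Real.log T) := by
  classical
  obtain ⟨K₁, hK₁, h₁⟩ := hV.bound
  obtain ⟨N, hN, -⟩ := hV.regular
  obtain ⟨K₂, hK₂, h₂⟩ := exists_sum_heightWeight_le hp.castSucc hθ
  refine ⟨K₁ * K₂ * 2 ^ (n - s), by positivity, fun B hB T hT hTB => ?_⟩
  have hL := one_le_log hB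
  have hlT := Real.log_nonneg hT
  have hB0 : 0 < B := by linarith
  set K := K₁ * K₂ * 2 ^ (n - s) * (B * Real.log B ^ (q + (n - s))) with hK
  have hK0 : 0 ≤ K := by positivity
  have hcont : ∀ η : Fin n → ℕ+, IntervalIntegrable
      (fun t => V (Fin.snoc (α := fun _ => ℝ) (toReal η) t) B) volume 1 T := fun η => by
    refine ContinuousOn.intervalIntegrable ?_
    rw [Set.uIcc_of_le hT]
    exact (hN B hB (toReal η) fun i => (toReal_pos η i).le).1.continuousOn.mono
      (Set.Icc_subset_Icc_right hTB)
  have hpt : ∀ t : ℝ, 1 ≤ t → ∑ η ∈ box (fun _ : Fin n => ⌊B⌋₊),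
      θ η * V (Fin.snoc (α := fun _ => ℝ) (toReal η) t) B ≤ K * t⁻¹ := by
    intro t ht
    have ht0 : 0 < t := by linarith
    have hG := h₂ (fun _ => ⌊B⌋₊) (fun i => if ∃ j, i = p j then 1 else 1 + Real.log B) ?_ ?_
      (fun j => B ^ (-ε) * t ^ k (Fin.last n) j)
      (fun j => mul_pos (Real.rpow_pos_of_pos hB0 _) (Real.rpow_pos_of_pos ht0 _))
    · rw [prod_ite_range hp.castSucc.injective] at hG
      calc _ ≤ ∑ η ∈ box (fun _ : Fin n => ⌊B⌋₊), K₁ * (B * Real.log B ^ q) * t⁻¹ *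
            (θ η * (invProd (toReal η) * heightWeight (fun i => k i.castSucc)
              (fun j => B ^ (-ε) * t ^ k (Fin.last n) j) (toReal η))) := by
            refine Finset.sum_le_sum fun η _ => ?_
            refine (mul_le_mul_of_nonneg_left
              (h₁ B hB _ (snoc_pos (toReal_pos η) ht0)) (hθ0 η)).trans_eq ?_
            rw [invProd_snoc, heightWeight_snoc]
            ring
        _ ≤ K₁ * (B * Real.log B ^ q) * t⁻¹ * (K₂ * (2 * Real.log B) ^ (n - s)) := by
            rw [← Finset.mul_sum]
            refine mul_le_mul_of_nonneg_left (hG.trans ?_) (by positivity)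
            gcongr
            linarith
        _ = _ := by
            rw [hK, mul_pow, pow_add]
            ring
    · intro i
      split_ifs <;> linarith
    · intro i hi
      rw [if_neg]
      · exact one_add_log_floor_le (by linarith)
      · rintro ⟨j, rfl⟩
        exact hi j rfl
  have hswap : ∑ η ∈ box (fun _ : Fin n => ⌊B⌋₊), θ η *
        ∫ t in (1 : ℝ)..T, V (Fin.snoc (α := fun _ => ℝ) (toReal η) t) B
      = ∫ t in (1 : ℝ)..T, ∑ η ∈ box (fun _ : Fin n => ⌊B⌋₊),
        θ η * V (Fin.snoc (α := fun _ => ℝ) (toReal η) t) B := by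
    rw [intervalIntegral.integral_finsetSum fun η _ => (hcont η).const_mul _]
    exact Finset.sum_congr rfl fun η _ => (intervalIntegral.integral_const_mul _ _).symm
  have h0 : (0 : ℝ) ∉ Set.uIcc 1 T := by
    rw [Set.uIcc_of_le hT]
    exact fun h => absurd h.1 (by norm_num)
  have hsumint : IntervalIntegrable (fun t => ∑ η ∈ box (fun _ : Fin n => ⌊B⌋₊),
      θ η * V (Fin.snoc (α := fun _ => ℝ) (toReal η) t) B) volume 1 T := by
    have := IntervalIntegrable.sum (box (fun _ : Fin n => ⌊B⌋₊))
      (f := fun η t => θ η * V (Fin.snoc (α := fun _ => ℝ) (toReal η) t) B)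
      fun η _ => (hcont η).const_mul (θ η)
    simpa only [Finset.sum_fn] using this
  have hinv : IntervalIntegrable (fun t : ℝ => t⁻¹) volume 1 T :=
    intervalIntegral.intervalIntegrable_inv (fun x hx h => h0 (h ▸ hx)) continuousOn_id
  calc _ ≤ ∫ t in (1 : ℝ)..T, K * t⁻¹ := by
        rw [hswap]
        exact intervalIntegral.integral_mono_on hT hsumint (hinv.const_mul _)
          fun t ht => hpt t ht.1
    _ = K * Real.log T := by
        rw [intervalIntegral.integral_const_mul, integral_inv h0, div_one]
    _ ≤ _ := mul_le_mul_of_nonneg_left (by linarith) hK0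

/-- The errors `E(θ(η₁, …, ηₙ₊₁), ηₙ₊₁)`, summed with weights `∏ (η i)⁻¹`, contribute only a power
of `log B`. -/
lemma exists_sum_error_le {C : ℝ} (hC : 0 ≤ C) {n : ℕ} {θ : (Fin n → ℕ+) → ℝ}
    (hθ : θ ∈ ThetaBound C n) :
    ∃ K : ℝ, 0 ≤ K ∧ ∀ B : ℝ, 3 ≤ B →
      ∑ η ∈ box (fun _ : Fin n => ⌊B⌋₊), θ η * invProd (toReal η)
        ≤ K * Real.log B ^ ((1 + C) * n) := by
  obtain ⟨K, hK, h⟩ := exists_sum_invProd_le hC hθ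
  refine ⟨K * 2 ^ ((1 + C) * n), by positivity, fun B hB => ?_⟩
  have hL := one_le_log hB
  have hfl : ((⌊B⌋₊ : ℕ) : ℝ) ≤ B := Nat.floor_le (by linarith)
  have h2L : 0 ≤ 2 * Real.log B := by linarith
  refine (h (fun _ => ⌊B⌋₊) (fun _ => (2 * Real.log B) ^ (1 + C)) fun i => ?_).trans_eq ?_
  · rw [Real.rpow_add (by linarith), Real.rpow_one]
    have h1 := one_add_log_floor_le (show 1 ≤ B by linarith)
    have h2 : Real.log ((⌊B⌋₊ : ℝ) + 2) ≤ 2 * Real.log B :=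
      (Real.log_le_log (by positivity) (by linarith)).trans (log_add_two_le hB)
    have h3 : 0 ≤ Real.log ((⌊B⌋₊ : ℝ) + 2) :=
      Real.log_nonneg (by linarith [(Nat.cast_nonneg ⌊B⌋₊ : (0 : ℝ) ≤ (⌊B⌋₊ : ℝ))])
    gcongr
    linarith
  · rw [Finset.prod_const, Finset.card_univ, Fintype.card_fin, ← Real.rpow_natCast,
      ← Real.rpow_mul h2L, Real.mul_rpow zero_le_two (by linarith)]
    ring

/-- Replacing the sum over the last variable by an integral. The sum and the integral are split at
`T = (log B)^D`: below `T`, both are small because `1 + log T` is of order `log log B`; above `T`,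
the error in the comparison gains a factor `T⁻¹`, which outweighs all powers of `log B`. -/
theorem exists_sum_sub_sum_lastIntegral_le {n s q : ℕ} {k : Fin (n + 1) → Fin s → ℝ} {ε : ℝ}
    {V : (Fin (n + 1) → ℝ) → ℝ → ℝ} (hV : IsControlled q k ε V) {p : Fin s → Fin n}
    (hp : IsPivot k fun j => (p j).castSucc) {C : ℝ} (hC : 0 ≤ C) {θ : (Fin (n + 1) → ℕ+) → ℝ}
    (hθ : θ ∈ ThetaAvgLast C n) :
    ∃ K : ℝ, 0 ≤ K ∧ ∀ B : ℝ, 3 ≤ B →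
      |∑ η ∈ box (fun _ : Fin (n + 1) => ⌊B⌋₊), θ η * V (toReal η) B
        - ∑ η ∈ box (fun _ : Fin n => ⌊B⌋₊), averageLast C θ η * lastIntegral V (toReal η) B|
      ≤ K * (B * Real.log B ^ (q + (n - s)) * Real.log (Real.log B)) := by
  obtain ⟨hθ0, hθavg, hθA, hθE⟩ := hθ
  have hA0 : ∀ η, 0 ≤ averageLast C θ η := fun η => (average_spec (hθavg η).2).1
  obtain ⟨N, hN, -⟩ := hV.regular
  obtain ⟨K₁, hK₁, h₁⟩ := hV.bound
  obtain ⟨K₂, hK₂, h₂⟩ := exists_sum_small_le hV hp hθ0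
  obtain ⟨K₃, hK₃, h₃⟩ := exists_integral_small_le hV hp hθA hA0
  obtain ⟨K₄, hK₄, h₄⟩ := exists_sum_error_le hC hθE
  set D : ℝ := q + C + (1 + C) * n + 1 with hD
  have hD0 : 0 < D := by positivity
  obtain ⟨K₅, hK₅, h₅⟩ := exists_log_rpow_le hD0
  set lam := Real.log (Real.log 3) with hlam
  have hlam0 : 0 < lam := log_log_three_pos
  set K₆ := (N + 3) * K₁ * K₅ * 2 ^ C * K₄ with hK₆
  have hK₆0 : 0 ≤ K₆ := by positivity
  refine ⟨(K₂ + K₃) * (lam⁻¹ + D) + K₆ * lam⁻¹, by positivity, fun B hB => ?_⟩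
  have hL := one_le_log hB
  have hB0 : 0 < B := by linarith
  set L := Real.log B with hLdef
  have hL0 : 0 < L := by linarith
  have hll : lam ≤ Real.log L := log_log_three_le hB
  have hone : 1 ≤ lam⁻¹ * Real.log L := by
    rw [← inv_mul_cancel₀ hlam0.ne']
    gcongr
  set T := min (L ^ D) B with hTdef
  have hT1 : 1 ≤ T := le_min (Real.one_le_rpow hL hD0.le) (by linarith)
  have hT0 : 0 < T := by linarith
  have hTB : T ≤ B := min_le_right _ _
  have hTinv : T⁻¹ ≤ K₅ * (L ^ D)⁻¹ := by
    have hpos : 0 < L ^ D := Real.rpow_pos_of_pos hL0 D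
    rw [← div_eq_mul_inv, le_div_iff₀ hpos, ← div_eq_inv_mul, div_le_iff₀ hT0, hTdef]
    rcases min_cases (L ^ D) B with h | h
    · rw [h.1]
      nlinarith
    · rw [h.1]
      exact h₅ B hB
  have hlogT : 1 + Real.log T ≤ (lam⁻¹ + D) * Real.log L := by
    have h := Real.log_le_log hT0 (min_le_left (L ^ D) B)
    rw [Real.log_rpow hL0] at h
    linarith
  -- The three contributions for fixed values of the other variables.
  set F : (Fin n → ℕ+) → ℝ → ℝ := fun η t => V (Fin.snoc (α := fun _ => ℝ) (toReal η) t) B with hF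
  have hFnn : ∀ η t, 0 ≤ t → 0 ≤ F η t := fun η t ht =>
    hV.nonneg B hB _ (snoc_nonneg (fun i => (toReal_pos η i).le) ht)
  have hFfew : ∀ η, HasFewSignChanges N 1 B (F η) := fun η =>
    hN B hB (toReal η) fun i => (toReal_pos η i).le
  set S : (Fin n → ℕ+) → ℝ := fun η => K₁ * (B * L ^ q) * (invProd (toReal η) * T⁻¹) with hS
  have hFS : ∀ η, ∀ t ∈ Set.Icc T B, F η t ≤ S η := by
    intro η t ht
    have ht0 : 0 < t := hT0.trans_le ht.1
    have hpos := snoc_pos (toReal_pos η) ht0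
    refine (h₁ B hB _ hpos).trans ?_
    have hY : ∀ j : Fin s, 0 < (fun _ => B ^ (-ε)) j := fun _ => Real.rpow_pos_of_pos hB0 _
    have hw := heightWeight_le_one k hY hpos
    have hip := invProd_nonneg (toReal_pos η)
    have hip' := invProd_nonneg hpos
    have hti : t⁻¹ ≤ T⁻¹ := inv_anti₀ hT0 ht.1
    refine mul_le_mul_of_nonneg_left ?_ (by positivity)
    refine (mul_le_of_le_one_right hip' hw).trans ?_
    rw [invProd_snoc]
    gcongr
  set err : (Fin n → ℕ+) → ℝ := fun η => errorSupLast C θ η * (2 * L) ^ C with herr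
  have hR : ∀ η, ∀ t ∈ Set.Icc T B,
      |partialSum (lastSlice θ η) t - averageLast C θ η * t| ≤ err η := by
    intro η t ht
    have ht0 : 0 < t := hT0.trans_le ht.1
    refine (abs_partialSum_sub_average_le (hθavg η).2 ht0.le).trans ?_
    refine mul_le_mul_of_nonneg_left ?_ (errorSup_nonneg _ _)
    exact Real.rpow_le_rpow (Real.log_nonneg (by linarith))
      ((Real.log_le_log (by linarith) (by linarith [ht.2])).trans (log_add_two_le hB)) hC
  have hone_var : ∀ η : Fin n → ℕ+,
      |∑ m ∈ Finset.range ⌊B⌋₊, θ (Fin.snoc (α := fun _ => ℕ+) η m.succPNat) * F η ((m : ℝ) + 1)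
        - averageLast C θ η * lastIntegral V (toReal η) B|
      ≤ ∑ m ∈ Finset.range ⌊T⌋₊, θ (Fin.snoc (α := fun _ => ℕ+) η m.succPNat) * F η ((m : ℝ) + 1)
        + averageLast C θ η * (∫ t in (1 : ℝ)..T, F η t) + (N + 3) * S η * err η := by
    intro η
    have habel := abs_sum_sub_integral_le (θ := lastSlice θ η) (f := F η) (by linarith) hT1 hTB
      (hFfew η) (fun t ht => hFnn η t (hT0.le.trans ht.1)) (hFS η) (hR η)
    have hsplit := Finset.sum_range_add_sum_Ico
      (fun m : ℕ => θ (Fin.snoc (α := fun _ => ℕ+) η m.succPNat) * F η ((m : ℝ) + 1))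
      (Nat.floor_le_floor hTB)
    have hcont : ∀ a b, 1 ≤ a → a ≤ b → b ≤ B → IntervalIntegrable (F η) volume a b := by
      intro a b ha hab hb
      refine ContinuousOn.intervalIntegrable ?_
      rw [Set.uIcc_of_le hab]
      exact (hFfew η).1.continuousOn.mono (Set.Icc_subset_Icc ha hb)
    have hint : lastIntegral V (toReal η) B
        = (∫ t in (1 : ℝ)..T, F η t) + ∫ t in T..B, F η t := by
      rw [hV.lastIntegral_eq hB fun i => (toReal_pos η i).le]
      exact (intervalIntegral.integral_add_adjacent_intervals (hcont 1 T le_rfl hT1 hTB)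
        (hcont T B hT1 hTB le_rfl)).symm
    have h1 : 0 ≤ ∑ m ∈ Finset.range ⌊T⌋₊,
        θ (Fin.snoc (α := fun _ => ℕ+) η m.succPNat) * F η ((m : ℝ) + 1) :=
      Finset.sum_nonneg fun m _ => mul_nonneg (hθ0.1 _) (hFnn η _ (by positivity))
    have h2 : 0 ≤ averageLast C θ η * ∫ t in (1 : ℝ)..T, F η t :=
      mul_nonneg (hA0 η) (intervalIntegral.integral_nonneg hT1 fun t ht =>
        hFnn η t (zero_le_one.trans ht.1))
    rw [← hsplit, hint, mul_add]
    unfold lastSlice at habel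
    rw [abs_le] at habel ⊢
    constructor <;> linarith [habel.1, habel.2]
  have hbig : ∑ η ∈ box (fun _ : Fin n => ⌊B⌋₊), (N + 3) * S η * err η ≤ K₆ * B := by
    have h := h₄ B hB
    have hC0 : (0 : ℝ) ≤ (2 * L) ^ C := Real.rpow_nonneg (by linarith) C
    have hE0 : 0 ≤ ∑ η ∈ box (fun _ : Fin n => ⌊B⌋₊), errorSupLast C θ η * invProd (toReal η) :=
      Finset.sum_nonneg fun η _ =>
        mul_nonneg (errorSup_nonneg _ _) (invProd_nonneg (toReal_pos η))
    calc _ = (N + 3) * K₁ * (B * L ^ q) * T⁻¹ * (2 * L) ^ C *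
          ∑ η ∈ box (fun _ : Fin n => ⌊B⌋₊), errorSupLast C θ η * invProd (toReal η) := by
          rw [Finset.mul_sum]
          refine Finset.sum_congr rfl fun η _ => ?_
          simp only [hS, herr]
          ring
      _ ≤ (N + 3) * K₁ * (B * L ^ q) * (K₅ * (L ^ D)⁻¹) * (2 * L) ^ C *
          (K₄ * L ^ ((1 + C) * n)) := by gcongr
      _ = K₆ * B * (L ^ (q : ℝ) * L ^ C * L ^ ((1 + C) * n) * (L ^ D)⁻¹) := by
          rw [hK₆, Real.mul_rpow zero_le_two hL0.le, Real.rpow_natCast]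
          ring
      _ = K₆ * B * L ^ (-1 : ℝ) := by
          rw [← Real.rpow_add hL0, ← Real.rpow_add hL0, ← Real.rpow_neg hL0.le,
            ← Real.rpow_add hL0]
          congr 2
          rw [hD]
          ring
      _ ≤ K₆ * B * 1 := by
          gcongr
          exact Real.rpow_le_one_of_one_le_of_nonpos hL (by norm_num)
      _ = K₆ * B := mul_one _
  have hBL : B ≤ B * L ^ (q + (n - s)) := le_mul_of_one_le_right hB0.le (one_le_pow₀ hL)
  have hBL0 : 0 ≤ B * L ^ (q + (n - s)) := by positivity
  have hsum := sum_box_snoc (fun _ : Fin (n + 1) => ⌊B⌋₊) fun η => θ η * V (toReal η) B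
  simp only [toReal_snoc] at hsum
  rw [hsum, ← Finset.sum_sub_distrib]
  refine (Finset.abs_sum_le_sum_abs _ _).trans
    ((Finset.sum_le_sum fun η _ => hone_var η).trans ?_)
  rw [Finset.sum_add_distrib, Finset.sum_add_distrib]
  have e2 := h₂ B hB T hT1
  have e3 := h₃ B hB T hT1 hTB
  calc _ ≤ K₂ * (B * L ^ (q + (n - s))) * (1 + Real.log T)
        + K₃ * (B * L ^ (q + (n - s))) * (1 + Real.log T) + K₆ * B :=
        add_le_add (add_le_add e2 e3) hbig
    _ ≤ K₂ * (B * L ^ (q + (n - s))) * ((lam⁻¹ + D) * Real.log L)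
        + K₃ * (B * L ^ (q + (n - s))) * ((lam⁻¹ + D) * Real.log L)
        + K₆ * (B * L ^ (q + (n - s)) * (lam⁻¹ * Real.log L)) := by
        gcongr
        exact hBL.trans (le_mul_of_one_le_right hBL0 hone)
    _ = _ := by ring

/-! ### Integrating out the last variable -/

lemma IsControlled.intervalIntegrable {n s q : ℕ} {k : Fin (n + 1) → Fin s → ℝ} {ε : ℝ}
    {V : (Fin (n + 1) → ℝ) → ℝ → ℝ} (hV : IsControlled q k ε V) {B : ℝ} (hB : 3 ≤ B)
    {x : Fin n → ℝ} (hx : ∀ i, 0 ≤ x i) :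
    IntervalIntegrable (fun t => V (Fin.snoc (α := fun _ => ℝ) x t) B) volume 1 B := by
  obtain ⟨N, hN, -⟩ := hV.regular
  refine ContinuousOn.intervalIntegrable ?_
  rw [Set.uIcc_of_le (by linarith)]
  exact (hN B hB x hx).1.continuousOn

/-- The properties other than the upper bound are inherited by `∫ V dηₙ₊₁`. -/
lemma IsControlled.lastIntegral {n s s' q q' : ℕ} {k : Fin (n + 1) → Fin s → ℝ}
    {k' : Fin n → Fin s' → ℝ} {ε : ℝ} {V : (Fin (n + 1) → ℝ) → ℝ → ℝ} (hV : IsControlled q k ε V)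
    (hbound : ∃ K : ℝ, 0 ≤ K ∧ ∀ B : ℝ, 3 ≤ B → ∀ x : Fin n → ℝ, (∀ i, 0 < x i) →
      SeveralSummations.lastIntegral V x B
        ≤ K * (B * Real.log B ^ q') * (invProd x * heightWeight k' (fun _ => B ^ (-ε)) x)) :
    IsControlled q' k' ε (SeveralSummations.lastIntegral V) where
  nonneg B hB x hx := by
    rw [hV.lastIntegral_eq hB hx]
    exact intervalIntegral.integral_nonneg (by linarith) fun t ht =>
      hV.nonneg B hB _ (snoc_nonneg hx (zero_le_one.trans ht.1))
  range B hB x hx hne i := by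
    by_contra hcon
    refine hne ?_
    rw [hV.lastIntegral_eq hB hx]
    refine (intervalIntegral.integral_congr (g := fun _ => 0) fun t ht => ?_).trans (by simp)
    rw [Set.uIcc_of_le (by linarith)] at ht
    by_contra hne'
    have h := hV.range B hB _ (snoc_nonneg hx (zero_le_one.trans ht.1)) hne' i.castSucc
    rw [Fin.snoc_castSucc] at h
    exact hcon h
  regular := hV.regular.imp fun _ h => h.2
  bound := hbound

/-- Without height conditions, the integral over a variable costs a factor `log B`. -/
lemma IsControlled.lastIntegral_log {n q : ℕ} {k : Fin (n + 1) → Fin 0 → ℝ} {ε : ℝ}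
    {V : (Fin (n + 1) → ℝ) → ℝ → ℝ} (hV : IsControlled q k ε V) :
    IsControlled (q + 1) (fun i => k i.castSucc) ε (SeveralSummations.lastIntegral V) := by
  refine hV.lastIntegral ?_
  obtain ⟨K, hK, h⟩ := hV.bound
  refine ⟨K, hK, fun B hB x hx => ?_⟩
  rw [hV.lastIntegral_eq hB fun i => (hx i).le]
  have hB1 : 1 ≤ B := by linarith
  have h0 : (0 : ℝ) ∉ Set.uIcc 1 B := by
    rw [Set.uIcc_of_le hB1]
    exact fun h => absurd h.1 (by norm_num)
  have hinv : IntervalIntegrable (fun t : ℝ => t⁻¹) volume 1 B :=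
    intervalIntegral.intervalIntegrable_inv (fun x hx h => h0 (h ▸ hx)) continuousOn_id
  calc _ ≤ ∫ t in (1 : ℝ)..B, K * (B * Real.log B ^ q) * invProd x * t⁻¹ := by
        refine intervalIntegral.integral_mono_on hB1 (hV.intervalIntegrable hB fun i => (hx i).le)
          (hinv.const_mul _) fun t ht => ?_
        refine (h B hB _ (snoc_pos hx (zero_lt_one.trans_le ht.1))).trans_eq ?_
        rw [invProd_snoc, heightWeight, Finset.univ_eq_empty, Finset.prod_empty]
        ring
    _ = _ := by
        rw [intervalIntegral.integral_const_mul, integral_inv h0, div_one, heightWeight,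
          Finset.univ_eq_empty, Finset.prod_empty, pow_succ]
        ring

/-- If the last variable occurs in the last height condition only, then integrating over it uses
up this condition, at the cost of a constant factor. -/
lemma IsControlled.lastIntegral_height {n s q : ℕ} {k : Fin (n + 1) → Fin (s + 1) → ℝ} {ε : ℝ}
    {V : (Fin (n + 1) → ℝ) → ℝ → ℝ} (hV : IsControlled q k ε V)
    (hk0 : ∀ j : Fin s, k (Fin.last n) j.castSucc = 0) (hk : k (Fin.last n) (Fin.last s) ≠ 0) :
    IsControlled q (fun i (j : Fin s) => k i.castSucc j.castSucc) ε
      (SeveralSummations.lastIntegral V) := by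
  refine hV.lastIntegral ?_
  obtain ⟨K, hK, h⟩ := hV.bound
  set κ := k (Fin.last n) (Fin.last s) with hκ
  refine ⟨K * (Real.pi / |κ|), by positivity, fun B hB x hx => ?_⟩
  rw [hV.lastIntegral_eq hB fun i => (hx i).le]
  have hB1 : 1 ≤ B := by linarith
  have hBε : 0 < B ^ (-ε) := Real.rpow_pos_of_pos (by linarith) _
  have hL := one_le_log hB
  set Z := B ^ (-ε) * monomial (fun i => k i.castSucc) (Fin.last s) x with hZdef
  have hZ : 0 < Z := mul_pos hBε (monomial_pos _ _ hx)
  set W := invProd x * heightWeight (fun i (j : Fin s) => k i.castSucc j.castSucc)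
    (fun _ => B ^ (-ε)) x with hW
  have hW0 : 0 ≤ W := mul_nonneg (invProd_nonneg hx) (heightWeight_nonneg _ (fun _ => hBε) hx)
  calc _ ≤ ∫ t in (1 : ℝ)..B, K * (B * Real.log B ^ q) * W * (t⁻¹ * bump (Z * t ^ κ)) := by
        refine intervalIntegral.integral_mono_on hB1 (hV.intervalIntegrable hB fun i => (hx i).le)
          ((intervalIntegrable_inv_mul_bump hZ hB1).const_mul _) fun t ht => ?_
        refine (h B hB _ (snoc_pos hx (zero_lt_one.trans_le ht.1))).trans_eq ?_
        rw [invProd_snoc, heightWeight, Fin.prod_univ_castSucc]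
        simp only [monomial_snoc, hk0, Real.rpow_zero, mul_one]
        rw [hW, heightWeight, hZdef, ← hκ, ← mul_assoc (B ^ (-ε))]
        simp only [monomial]
        ring
    _ ≤ K * (B * Real.log B ^ q) * W * (Real.pi / |κ|) := by
        rw [intervalIntegral.integral_const_mul]
        gcongr
        exact integral_inv_mul_bump_le hZ hk hB1
    _ = _ := by ring

/-! ### Iteration -/

lemma sum_box_zero (θ : (Fin 0 → ℕ+) → ℝ) (V : (Fin 0 → ℝ) → ℝ → ℝ) (C B : ℝ) (M : Fin 0 → ℕ) :
    ∑ η ∈ box M, θ η * V (toReal η) B = iteratedAverage C 0 θ * iteratedIntegral 0 V B := by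
  have : box M = {Fin.elim0} := by
    ext η
    simp [mem_box, Subsingleton.elim η Fin.elim0]
  rw [this, Finset.sum_singleton, Subsingleton.elim (toReal Fin.elim0) Fin.elim0]
  rfl

/-- Combines the error made by replacing one sum by an integral with the error of the remaining
summations. -/
lemma exists_combine_bound {f g h R : ℝ → ℝ}
    (hfg : ∃ K : ℝ, 0 ≤ K ∧ ∀ B : ℝ, 3 ≤ B → |f B - g B| ≤ K * R B)
    (hgh : ∃ K : ℝ, 0 ≤ K ∧ ∀ B : ℝ, 3 ≤ B → |g B - h B| ≤ K * R B) :
    ∃ K : ℝ, 0 ≤ K ∧ ∀ B : ℝ, 3 ≤ B → |f B - h B| ≤ K * R B := by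
  obtain ⟨K₁, hK₁, h₁⟩ := hfg
  obtain ⟨K₂, hK₂, h₂⟩ := hgh
  refine ⟨K₁ + K₂, add_nonneg hK₁ hK₂, fun B hB => ?_⟩
  rw [add_mul]
  exact (abs_sub_le _ _ _).trans (add_le_add (h₁ B hB) (h₂ B hB))

/-- The asymptotic formula without height conditions. The factor `(log B)^q` in the bound for `V`
stems from integrations that have already been carried out. -/
theorem exists_bound_of_no_height {C : ℝ} (hC : 0 ≤ C) : ∀ {n q : ℕ} {k : Fin n → Fin 0 → ℝ}
    {ε : ℝ} {V : (Fin n → ℝ) → ℝ → ℝ}, IsControlled q k ε V → ∀ {θ : (Fin n → ℕ+) → ℝ},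
    θ ∈ ThetaIter C n → ∃ K : ℝ, 0 ≤ K ∧ ∀ B : ℝ, 3 ≤ B →
      |∑ η ∈ box (fun _ : Fin n => ⌊B⌋₊), θ η * V (toReal η) B
        - iteratedAverage C n θ * iteratedIntegral n V B|
      ≤ K * (B * Real.log B ^ (q + n - 1) * Real.log (Real.log B)) := by
  intro n
  induction n with
  | zero =>
    intro q k ε V _ θ _
    refine ⟨0, le_rfl, fun B _ => ?_⟩
    rw [sum_box_zero _ _ C]
    simp
  | succ n ih =>
    intro q k ε V hV θ hθ
    have hp : IsPivot k fun j : Fin 0 => (j.elim0 : Fin n).castSucc :=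
      ⟨fun j => j.elim0, fun j => j.elim0, fun _ j => j.elim0⟩
    have h1 := exists_sum_sub_sum_lastIntegral_le hV hp hC hθ.1
    have h2 := ih hV.lastIntegral_log hθ.2
    rw [show q + 1 + n - 1 = q + (n - 0) by omega] at h2
    rw [show q + (n + 1) - 1 = q + (n - 0) by omega]
    exact exists_combine_bound h1 h2

/-- The asymptotic formula with `s` height conditions, by induction on `s` with fixed `r`. The
pivots lie among the first `r` variables, so they survive when the last variable is removed. -/
theorem exists_bound_of_height {C : ℝ} (hC : 0 ≤ C) {r : ℕ} : ∀ {s : ℕ}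
    {k : Fin (r + s) → Fin s → ℝ} {p : Fin s → Fin r}, IsPivot k (fun j => (p j).castAdd s) →
    (∀ (i : Fin (r + s)) (j : Fin s), (i : ℕ) = r + j → k i j ≠ 0) →
    (∀ (i : Fin (r + s)) (j : Fin s), r + (j : ℕ) < (i : ℕ) → k i j = 0) →
    ∀ {ε : ℝ} {V : (Fin (r + s) → ℝ) → ℝ → ℝ}, IsControlled 0 k ε V →
    ∀ {θ : (Fin (r + s) → ℕ+) → ℝ}, θ ∈ ThetaIter C (r + s) →
    ∃ K : ℝ, 0 ≤ K ∧ ∀ B : ℝ, 3 ≤ B →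
      |∑ η ∈ box (fun _ : Fin (r + s) => ⌊B⌋₊), θ η * V (toReal η) B
        - iteratedAverage C (r + s) θ * iteratedIntegral (r + s) V B|
      ≤ K * (B * Real.log B ^ (r - 1) * Real.log (Real.log B)) := by
  intro s
  induction s with
  | zero =>
    intro k p _ _ _ ε V hV θ hθ
    have h := exists_bound_of_no_height hC hV hθ
    rwa [show 0 + (r + 0) - 1 = r - 1 by omega] at h
  | succ s ih =>
    intro k p hp hne hzero ε V hV θ hθ
    have hp' : IsPivot (n := r + s + 1) k fun j => ((p j).castAdd s).castSucc := hp
    have h1 := exists_sum_sub_sum_lastIntegral_le (n := r + s) hV hp' hC hθ.1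
    have hV' := IsControlled.lastIntegral_height (n := r + s) hV
      (fun j => hzero _ _ (by simp [j.isLt])) (hne _ _ (by simp))
    have hpiv : IsPivot (fun (i : Fin (r + s)) (j : Fin s) => k i.castSucc j.castSucc)
        fun j => (p j.castSucc).castAdd s :=
      ⟨fun j => hp.ne_zero j.castSucc, fun j j' hj => hp.eq_zero j.castSucc j'.castSucc hj,
        fun _ _ => hp.abs_le_one _ _⟩
    have h2 := ih (p := fun j => p j.castSucc) hpiv (fun i j hij => hne i.castSucc j.castSucc hij)
      (fun i j hij => hzero i.castSucc j.castSucc hij) hV' hθ.2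
    rw [show 0 + (r + s - (s + 1)) = r - 1 by omega] at h1
    exact exists_combine_bound h1 h2

/-! ### Volume functions -/

/-- Scaling the exponents makes them bounded by `1`, as required for the weights
`t⁻¹ * bump (Y * t ^ κ)` to be antitone. -/
lemma exists_scaling {m s : ℕ} {a : Fin s → ℝ} (ha : ∀ j, 0 < a j) (k : Fin m → Fin s → ℝ) :
    ∃ ε : ℝ, 0 < ε ∧ (∀ j, ε ≤ a j) ∧ ∀ i j, |ε * k i j| ≤ 1 := by
  set A := ∑ j, (a j)⁻¹ with hA
  set E := ∑ i, ∑ j, |k i j| with hE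
  have hA0 : 0 ≤ A := Finset.sum_nonneg fun j _ => (inv_pos.mpr (ha j)).le
  have hE0 : 0 ≤ E := Finset.sum_nonneg fun i _ => Finset.sum_nonneg fun j _ => abs_nonneg _
  have hpos : 0 < 1 + A + E := by linarith
  refine ⟨(1 + A + E)⁻¹, inv_pos.mpr hpos, fun j => ?_, fun i j => ?_⟩
  · have h1 : (a j)⁻¹ ≤ A :=
      Finset.single_le_sum (f := fun j => (a j)⁻¹) (fun j _ => (inv_pos.mpr (ha j)).le)
        (Finset.mem_univ j)
    exact inv_le_of_inv_le₀ (ha j) (by linarith)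
  · have h1 : ∑ j, |k i j| ≤ E :=
      Finset.single_le_sum (f := fun i => ∑ j, |k i j|)
        (fun i _ => Finset.sum_nonneg fun j _ => abs_nonneg _) (Finset.mem_univ i)
    have h2 : |k i j| ≤ ∑ j, |k i j| :=
      Finset.single_le_sum (f := fun j => |k i j|) (fun j _ => abs_nonneg _) (Finset.mem_univ j)
    rw [abs_mul, abs_of_pos (inv_pos.mpr hpos), inv_mul_le_iff₀ hpos]
    linarith

lemma volume_bound_eq {m s : ℕ} (a : Fin s → ℝ) (k : Fin m → Fin s → ℝ) {B : ℝ} (hB : 0 < B)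
    {x : Fin m → ℝ} (hx : ∀ i, 0 < x i) :
    B ^ (1 - ∑ j, a j) / ∏ i, x i ^ (1 - ∑ j, a j * k i j)
      = B * (invProd x * ∏ j, (monomial k j x / B) ^ a j) := by
  have h1 : ∏ i, x i ^ (1 - ∑ j, a j * k i j) = (∏ i, x i) / ∏ j, monomial k j x ^ a j := by
    have h2 : ∏ j, monomial k j x ^ a j = ∏ i, x i ^ ∑ j, a j * k i j := by
      simp only [monomial]
      simp_rw [Real.rpow_sum_of_pos (hx _)]
      rw [Finset.prod_comm]
      refine Finset.prod_congr rfl fun j _ => ?_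
      rw [← Real.finsetProd_rpow _ _ fun i _ => Real.rpow_nonneg (hx i).le _]
      refine Finset.prod_congr rfl fun i _ => ?_
      rw [← Real.rpow_mul (hx i).le, mul_comm]
    rw [h2, ← Finset.prod_div_distrib]
    refine Finset.prod_congr rfl fun i _ => ?_
    rw [Real.rpow_sub (hx i), Real.rpow_one]
  have h3 : ∏ j, (monomial k j x / B) ^ a j = (∏ j, monomial k j x ^ a j) / B ^ ∑ j, a j := by
    rw [Real.rpow_sum_of_pos hB, ← Finset.prod_div_distrib]
    exact Finset.prod_congr rfl fun j _ =>
      Real.div_rpow (monomial_pos k j hx).le hB.le _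
  rw [h1, h3, Real.rpow_sub hB, Real.rpow_one, invProd, Finset.prod_inv_distrib, div_div_eq_mul_div]
  ring

lemma monomial_const_mul {m s : ℕ} (k : Fin m → Fin s → ℝ) (ε : ℝ) (j : Fin s) {x : Fin m → ℝ}
    (hx : ∀ i, 0 < x i) : monomial (fun i j => ε * k i j) j x = monomial k j x ^ ε := by
  unfold monomial
  rw [← Real.finsetProd_rpow _ _ fun i _ => Real.rpow_nonneg (hx i).le _]
  refine Finset.prod_congr rfl fun i _ => ?_
  rw [← Real.rpow_mul (hx i).le, mul_comm]

/-- On the support of a volume function, `y = (∏ i, η i ^ k i j) / B` is at most `1`, so that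
`y ^ a j ≤ y ^ ε`, and this is at most `2 * bump (y ^ ε)`. -/
lemma IsVolumeFunction.isControlled {r s : ℕ} {a : Fin s → ℝ} {k : Fin (r + s) → Fin s → ℝ}
    {V : (Fin (r + s) → ℝ) → ℝ → ℝ} (hV : IsVolumeFunction r s a k V) {ε : ℝ} (hε : 0 < ε)
    (hεa : ∀ j, ε ≤ a j) : IsControlled 0 (fun i j => ε * k i j) ε V where
  nonneg := hV.nonneg
  range := hV.range
  regular := hV.regular
  bound := by
    obtain ⟨K, h⟩ := hV.bound
    refine ⟨|K| * 2 ^ s, by positivity, fun B hB x hx => ?_⟩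
    have hB0 : 0 < B := by linarith
    have hY : ∀ j : Fin s, 0 < (fun _ => B ^ (-ε)) j := fun _ => Real.rpow_pos_of_pos hB0 _
    have hip := invProd_nonneg hx
    have hw := heightWeight_nonneg (fun i j => ε * k i j) hY hx
    by_cases hzero : V x B = 0
    · rw [hzero, pow_zero]
      positivity
    have hheight := hV.height B hB x (fun i => (hx i).le) hzero
    have hprod : ∏ j, (monomial k j x / B) ^ a j
        ≤ 2 ^ s * heightWeight (fun i j => ε * k i j) (fun _ => B ^ (-ε)) x := by
      have h2 : (2 : ℝ) ^ s = ∏ _j : Fin s, 2 := by simp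
      rw [h2, heightWeight, ← Finset.prod_mul_distrib]
      have hpos : ∀ j, 0 < monomial k j x / B := fun j => div_pos (monomial_pos k j hx) hB0
      refine Finset.prod_le_prod (fun j _ => Real.rpow_nonneg (hpos j).le _) fun j _ => ?_
      have hle : monomial k j x / B ≤ 1 := (div_le_one hB0).mpr (hheight j)
      have heq : B ^ (-ε) * monomial (fun i j => ε * k i j) j x = (monomial k j x / B) ^ ε := by
        rw [monomial_const_mul k ε j hx, Real.div_rpow (monomial_pos k j hx).le hB0.le,
          Real.rpow_neg hB0.le]
        ring
      rw [heq]
      exact (Real.rpow_le_rpow_of_exponent_ge (hpos j) hle (hεa j)).trans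
        (le_two_mul_bump (Real.rpow_pos_of_pos (hpos j) _)
          (Real.rpow_le_one (hpos j).le hle hε.le))
    refine (h B hB x hx).trans ?_
    rw [volume_bound_eq a k hB0 hx]
    have hnn : 0 ≤ ∏ j, (monomial k j x / B) ^ a j :=
      Finset.prod_nonneg fun j _ => Real.rpow_nonneg (div_pos (monomial_pos k j hx) hB0).le _
    calc _ ≤ |K| * (B * (invProd x * ∏ j, (monomial k j x / B) ^ a j)) :=
          mul_le_mul_of_nonneg_right (le_abs_self K) (by positivity)
      _ ≤ |K| * (B * (invProd x *
          (2 ^ s * heightWeight (fun i j => ε * k i j) (fun _ => B ^ (-ε)) x))) := by gcongr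
      _ = _ := by ring

lemma tsum_eq_sum_box {r s : ℕ} {a : Fin s → ℝ} {k : Fin (r + s) → Fin s → ℝ}
    {V : (Fin (r + s) → ℝ) → ℝ → ℝ} (hV : IsVolumeFunction r s a k V)
    (θ : (Fin (r + s) → ℕ+) → ℝ) {B : ℝ} (hB : 3 ≤ B) :
    ∑' η : Fin (r + s) → ℕ+, θ η * V (fun i => ((η i : ℕ) : ℝ)) B
      = ∑ η ∈ box (fun _ : Fin (r + s) => ⌊B⌋₊), θ η * V (toReal η) B := by
  refine tsum_eq_sum fun η hη => ?_
  by_contra hne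
  refine hη (mem_box.mpr fun i => Nat.le_floor ?_)
  exact (hV.range B hB _ (fun i => (toReal_pos η i).le) (right_ne_zero_of_mul hne) i).2

end SeveralSummations

end

theorem mainTheorem2 (r s : ℕ) (hrs : s ≤ r)
    (a : Fin s → ℝ) (ha : ∀ j, 0 < a j)
    (k : Fin (r + s) → Fin s → ℝ) (hk : SeveralSummations.AdmissibleExponents r s k)
    (V : (Fin (r + s) → ℝ) → ℝ → ℝ) (hV : SeveralSummations.IsVolumeFunction r s a k V)
    (C : ℝ) (hC : 0 ≤ C)
    (θ : (Fin (r + s) → ℕ+) → ℝ) (hθ : θ ∈ SeveralSummations.ThetaIter C (r + s)) :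
    ∃ K : ℝ, ∀ B : ℝ, 3 ≤ B →
      |(∑' η : Fin (r + s) → ℕ+, θ η * V (fun i => ((η i : ℕ) : ℝ)) B)
          - SeveralSummations.iteratedAverage C (r + s) θ
            * SeveralSummations.iteratedIntegral (r + s) V B|
        ≤ K * (B * Real.log B ^ ((r : ℝ) - 1) * Real.log (Real.log B) ^ max 1 s) := by
  open SeveralSummations in
  rcases Nat.eq_zero_or_pos r with rfl | hr
  · -- There are no variables, and both sides of the asymptotic formula agree.
    obtain rfl : s = 0 := by omega
    refine ⟨0, fun B hB => ?_⟩
    rw [tsum_eq_sum_box hV θ hB]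
    have h := sum_box_zero θ V C B (fun _ => ⌊B⌋₊)
    rw [show ∑ η ∈ box (fun _ : Fin (0 + 0) => ⌊B⌋₊), θ η * V (toReal η) B
      = iteratedAverage C (0 + 0) θ * iteratedIntegral (0 + 0) V B from h]
    simp
  obtain ⟨ε, hε, hεa, hεk⟩ := exists_scaling ha k
  have hpiv : IsPivot (fun i j => ε * k i j)
      fun j => (⟨r - s + j, by omega⟩ : Fin r).castAdd s := by
    refine ⟨fun j => mul_ne_zero hε.ne' (hk.ne_zero_left _ _ ?_), fun j j' hj => ?_, hεk⟩
    · simp only [Fin.val_castAdd]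
      omega
    · rw [Fin.lt_def] at hj
      rw [hk.eq_zero_left _ _ (by simp only [Fin.val_castAdd]; omega)
        (by simp only [Fin.val_castAdd]; omega), mul_zero]
  obtain ⟨K, hK, h⟩ := exists_bound_of_height hC hpiv
    (fun i j hij => mul_ne_zero hε.ne' (hk.ne_zero_right i j hij))
    (fun i j hij => by rw [hk.eq_zero_right i j hij, mul_zero]) (hV.isControlled hε hεa) hθ
  set lam := Real.log (Real.log 3) with hlam
  have hlam0 : 0 < lam := log_log_three_pos
  refine ⟨K * (lam ^ (max 1 s - 1))⁻¹, fun B hB => ?_⟩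
  rw [tsum_eq_sum_box hV θ hB]
  refine (h B hB).trans ?_
  have hL := one_le_log hB
  have hll : lam ≤ Real.log (Real.log B) := log_log_three_le hB
  have hpow : Real.log B ^ ((r : ℝ) - 1) = Real.log B ^ (r - 1) := by
    rw [← Real.rpow_natCast, Nat.cast_sub hr, Nat.cast_one]
  -- Only one factor `log log B` arises; the others are bounded below by `log log 3 > 0`.
  have hlog : Real.log (Real.log B)
      ≤ (lam ^ (max 1 s - 1))⁻¹ * Real.log (Real.log B) ^ max 1 s := by
    obtain ⟨m, hm⟩ : ∃ m, max 1 s = m + 1 := ⟨max 1 s - 1, by omega⟩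
    rw [hm, Nat.add_sub_cancel, pow_succ, ← mul_assoc]
    refine le_mul_of_one_le_left (by linarith) ?_
    rw [← div_eq_inv_mul, one_le_div (by positivity)]
    gcongr
  rw [hpow]
  calc _ ≤ K * (B * Real.log B ^ (r - 1) *
        ((lam ^ (max 1 s - 1))⁻¹ * Real.log (Real.log B) ^ max 1 s)) := by
        have hB0 : 0 ≤ B := by linarith
        gcongr
    _ = _ := by ring
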